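/- For a semigroup $S$ with set of idempotents $E=E(S)$, the biordered set of $S$ is the partial algebra $\mathcal{E}=(E,*)$ in which $e*f$ is defined, with value $ef$, exactly when $(e,f)$ is a basic pair, i.e. $\{e,f\}\cap\{ef,fe\}\neq\varnothing$. A finite biordered set is a partial algebra with finite underlying set arising in this way from some (not necessarily finite) semigroup. The free idempotent generated semigroup over $\mathcal{E}$ is the semigroup given by the presentation $$\mathrm{IG}(\mathcal{E})=\langle\, E \mid ef=e*f\ \text{ for all basic pairs } (e,f)\,\rangle,$$ and for $e\in E$ its maximal subgroup $H_e$ is the $\mathscr{H}$-class of $e$ in $\mathrm{IG}(\mathcal{E})$, a group with identity $e$. An element $a$ of a semigroup is regular if $aa'a=a$ for some element $a'$. Words are elements of the free monoid $E^*$; the empty word represents no element of $\mathrm{IG}(\mathcal{E})$. Theorem. (1) There is an algorithm which takes any finite biordered set $\mathcal{E}$ (given by its partial multiplication table) and computes finite presentations of each of the maximal subgroups $H_e$ $(e\in E)$ of $\mathrm{IG}(\mathcal{E})$. (2) Let $\mathcal{E}$ be a finite biordered set. If each of the (finitely presented) groups $H_e$ $(e\in E)$ has solvable word problem, then there is an algorithm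 which, given any two words $u,v\in E^*$, decides whether both $u$ and $v$ represent regular elements of $\mathrm{IG}(\mathcal{E})$ and, if they do, decides whether $u=v$ in $\mathrm{IG}(\mathcal{E})$. -/

import Mathlib

universe u

section Green

variable {S : Type u} [Semigroup S]

/-- The principal right ideal `a S¹ = {a} ∪ a S`. -/
def principalRightIdeal (a : S) : Set S := {x | x = a ∨ ∃ s, x = a * s}

/-- The principal left ideal `S¹ a = {a} ∪ S a`. -/
def principalLeftIdeal (a : S) : Set S := {x | x = a ∨ ∃ s, x = s * a}

/-- Green's relation `R`. -/
def GreenR (a b : S) : Prop := principalRightIdeal a = principalRightIdeal b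

/-- Green's relation `L`. -/
def GreenL (a b : S) : Prop := principalLeftIdeal a = principalLeftIdeal b

/-- Green's relation `H = R ∩ L`. -/
def GreenH (a b : S) : Prop := GreenR a b ∧ GreenL a b

/-- Von Neumann regularity of an element. -/
def IsRegularElement (a : S) : Prop := ∃ a' : S, a * a' * a = a

/-- `{e, f} ∩ {ef, fe} ≠ ∅`. -/
def IsBasicPair (e f : S) : Prop := (({e, f} : Set S) ∩ {e * f, f * e}).Nonempty

/-- The `H`-class of `e`. -/
def HClass (e : S) : Type u := {x : S // GreenH x e}

theorem greenR_iff_of_idem {e x : S} (he : e * e = e) :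
    GreenR x e ↔ e * x = x ∧ ∃ y, x * y = e := by
  constructor
  · intro h
    have h1 : x ∈ principalRightIdeal e := h ▸ (Or.inl rfl : x ∈ principalRightIdeal x)
    have h2 : e ∈ principalRightIdeal x := h.symm ▸ (Or.inl rfl : e ∈ principalRightIdeal e)
    have hx : e * x = x := by
      rcases h1 with rfl | ⟨s, rfl⟩
      · exact he
      · rw [← mul_assoc, he]
    refine ⟨hx, ?_⟩
    rcases h2 with h2 | ⟨s, hs⟩
    · exact ⟨e, by rw [← h2, he]⟩
    · exact ⟨s, hs.symm⟩
  · rintro ⟨hx, y, hy⟩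
    ext z
    constructor
    · rintro (rfl | ⟨s, rfl⟩)
      · exact Or.inr ⟨z, hx.symm⟩
      · exact Or.inr ⟨x * s, by rw [← mul_assoc, hx]⟩
    · rintro (rfl | ⟨s, rfl⟩)
      · exact Or.inr ⟨y, hy.symm⟩
      · exact Or.inr ⟨y * s, by rw [← mul_assoc, hy]⟩

theorem greenL_iff_of_idem {e x : S} (he : e * e = e) :
    GreenL x e ↔ x * e = x ∧ ∃ y, y * x = e := by
  constructor
  · intro h
    have h1 : x ∈ principalLeftIdeal e := h ▸ (Or.inl rfl : x ∈ principalLeftIdeal x)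
    have h2 : e ∈ principalLeftIdeal x := h.symm ▸ (Or.inl rfl : e ∈ principalLeftIdeal e)
    have hx : x * e = x := by
      rcases h1 with rfl | ⟨s, rfl⟩
      · exact he
      · rw [mul_assoc, he]
    refine ⟨hx, ?_⟩
    rcases h2 with h2 | ⟨s, hs⟩
    · exact ⟨e, by rw [← h2, he]⟩
    · exact ⟨s, hs.symm⟩
  · rintro ⟨hx, y, hy⟩
    ext z
    constructor
    · rintro (rfl | ⟨s, rfl⟩)
      · exact Or.inr ⟨z, hx.symm⟩
      · exact Or.inr ⟨s * x, by rw [mul_assoc, hx]⟩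
    · rintro (rfl | ⟨s, rfl⟩)
      · exact Or.inr ⟨y, hy.symm⟩
      · exact Or.inr ⟨s * y, by rw [mul_assoc, hy]⟩

theorem GreenH.mul {e x x' : S} (he : e * e = e) (h : GreenH x e) (h' : GreenH x' e) :
    GreenH (x * x') e := by
  obtain ⟨h1, y, h2⟩ := (greenR_iff_of_idem he).1 h.1
  obtain ⟨h3, z, h4⟩ := (greenL_iff_of_idem he).1 h.2
  obtain ⟨h1', y', h2'⟩ := (greenR_iff_of_idem he).1 h'.1
  obtain ⟨h3', z', h4'⟩ := (greenL_iff_of_idem he).1 h'.2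
  constructor
  · refine (greenR_iff_of_idem he).2 ⟨by rw [← mul_assoc, h1], y' * y, ?_⟩
    rw [mul_assoc, ← mul_assoc x', h2', ← mul_assoc, h3, h2]
  · refine (greenL_iff_of_idem he).2 ⟨by rw [mul_assoc, h3'], z' * z, ?_⟩
    rw [mul_assoc, ← mul_assoc z, h4, h1', h4']

theorem GreenH.exists_inv {e x : S} (he : e * e = e) (h : GreenH x e) :
    ∃ y, GreenH y e ∧ y * x = e := by
  obtain ⟨h1, y, h2⟩ := (greenR_iff_of_idem he).1 h.1
  obtain ⟨h3, z, h4⟩ := (greenL_iff_of_idem he).1 h.2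
  have key : e * y = z * e := by rw [← h4, mul_assoc, h2, h4]
  have hx : e * y * x = e := by rw [key, mul_assoc, h1, h4]
  have hx' : x * (e * y) = e := by rw [← mul_assoc, h3, h2]
  refine ⟨e * y, ⟨?_, ?_⟩, hx⟩
  · exact (greenR_iff_of_idem he).2 ⟨by rw [← mul_assoc, he], x, hx⟩
  · exact (greenL_iff_of_idem he).2 ⟨by rw [key, mul_assoc, he], x, hx'⟩

/-- The `H`-class of an idempotent `e` is a group under the multiplication of the semigroup,
with identity `e`. -/
@[reducible] noncomputable def HClass.group (e : S) (he : e * e = e) : Group (HClass e) :=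
  letI : Mul (HClass e) := ⟨fun x y => ⟨x.1 * y.1, GreenH.mul he x.2 y.2⟩⟩
  letI : One (HClass e) := ⟨⟨e, rfl, rfl⟩⟩
  letI : Inv (HClass e) := ⟨fun x => ⟨(x.2.exists_inv he).choose,
    (x.2.exists_inv he).choose_spec.1⟩⟩
  Group.ofLeftAxioms
    (fun x y z => Subtype.ext (mul_assoc x.1 y.1 z.1))
    (fun x => Subtype.ext ((greenR_iff_of_idem he).1 x.2.1).1)
    (fun x => Subtype.ext (x.2.exists_inv he).choose_spec.2)

end Green

/-- A biordered set with underlying set `E`: the partial algebra of idempotents of some semigroup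
`S`, in which `e * f` is defined, with value `ef`, exactly when `(e, f)` is a basic pair
(`op e f = none` means that the product is undefined). -/
structure BiorderedSet (E : Type u) where
  op : E → E → Option E
  exists_semigroup : ∃ (S : Type u) (_ : Semigroup S) (φ : E ≃ {s : S // s * s = s}),
    ∀ e f g : E, op e f = some g ↔
      IsBasicPair (φ e : S) (φ f : S) ∧ (φ e : S) * (φ f : S) = (φ g : S)

namespace BiorderedSet

variable {E : Type u} (B : BiorderedSet E)

theorem op_self (e : E) : B.op e e = some e := by
  obtain ⟨S, _, φ, h⟩ := B.exists_semigroup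
  refine (h e e e).2 ⟨⟨(φ e : S), by simp, ?_⟩, (φ e).2⟩
  simp [(φ e).2]

/-- The defining relations `ef = e * f`, for `(e, f)` a basic pair. -/
inductive Rel : FreeSemigroup E → FreeSemigroup E → Prop
  | basic (e f g : E) (h : B.op e f = some g) :
      Rel (FreeSemigroup.of e * FreeSemigroup.of f) (FreeSemigroup.of g)

/-- The free idempotent generated semigroup `IG(E)`, as the semigroup given by the presentation
`⟨E | ef = e * f ((e, f) a basic pair)⟩`. -/
def IG : Type u := (conGen B.Rel).Quotient

instance : Semigroup B.IG := inferInstanceAs (Semigroup (conGen B.Rel).Quotient)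

/-- The element of `IG(E)` represented by the generator `e`. -/
def of (e : E) : B.IG := ((FreeSemigroup.of e : FreeSemigroup E) : (conGen B.Rel).Quotient)

theorem of_mul_self (e : E) : B.of e * B.of e = B.of e :=
  (Con.eq (conGen B.Rel)).2 (ConGen.Rel.of _ _ (Rel.basic e e e (B.op_self e)))

/-- The maximal subgroup `H_e` of `IG(E)`. -/
def MaximalSubgroup (e : E) : Type u := HClass (B.of e)

noncomputable instance (e : E) : Group (B.MaximalSubgroup e) :=
  HClass.group (B.of e) (B.of_mul_self e)

/-- The value of a word over `E` in `IG(E)` with an identity adjoined; the empty word is sent to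
the adjoined identity, so it represents no element of `IG(E)`. -/
def value (w : List E) : WithOne B.IG := (w.map fun e => (B.of e : WithOne B.IG)).prod

/-- The word `w` represents a regular element of `IG(E)`. -/
def IsRegularWord (w : List E) : Prop :=
  ∃ x : B.IG, B.value w = (x : WithOne B.IG) ∧ IsRegularElement x

/-- The partial multiplication table of a biordered set on `{0, …, n - 1}`: the form in which it
is given to an algorithm. -/
def table {n : ℕ} (B : BiorderedSet (Fin n)) : List (List (Option ℕ)) :=
  List.ofFn fun i => List.ofFn fun j => (B.op i j).map Fin.val

end BiorderedSet

/-- A finite group presentation as finite data: the number `k` of generators, and the list of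
relators; the letter `(i, true)` is the `i`-th generator, `(i, false)` its inverse. -/
abbrev FinPresentation : Type := ℕ × List (List (ℕ × Bool))

namespace FinPresentation

/-- Only the generators `0, …, k - 1` occur in the relators. -/
def WellFormed (P : FinPresentation) : Prop := ∀ r ∈ P.2, ∀ a ∈ r, a.1 < P.1

/-- The relators as elements of the free group on `k` generators. -/
def relators (P : FinPresentation) : Set (FreeGroup (Fin P.1)) :=
  {x | ∃ w : List (Fin P.1 × Bool),
    w.map (fun a => ((a.1 : ℕ), a.2)) ∈ P.2 ∧ x = FreeGroup.mk w}

/-- `P` is a finite presentation of the group `G`. -/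
def Presents (P : FinPresentation) (G : Type u) [Group G] : Prop :=
  P.WellFormed ∧ Nonempty (PresentedGroup P.relators ≃* G)

end FinPresentation

/-- A (finitely generated) group has solvable word problem: with respect to some finite generating
family it is decidable whether a word in the generators and their inverses is trivial. -/
def HasSolvableWordProblem (G : Type u) [Group G] : Prop :=
  ∃ (k : ℕ) (π : FreeGroup (Fin k) →* G), Function.Surjective π ∧
    ComputablePred fun w : List (Fin k × Bool) => π (FreeGroup.mk w) = 1

/-! Let `S` be a semigroup that realizes the biordered set. The natural map from `IG` to `S` shows
that `IG` creates no new relations `L`, `R` between generators, and no new cases of `f a` being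
`R`-related to `f` (`isFaithful_gen`). Whether `f a R f`, and which `L`-class then contains `f a`,
is visible in the table through a sandwich element. Letters therefore act partially on canonical
representatives of `L`-classes, and the action respects the defining relations
(`IsRightAction.bind_eq`). The opposite biordered set gives the action on `R`-classes from the left.

Regularity: a seed of a word is a letter `f` in `u f v` with `u f L f` and `f v R f`; such a word
represents an element of the `D`-class of `f`, and having a seed is invariant under rewriting
(`hasSeed_step_iff`). Conversely, the least number of seeded factors of a word is also invariant
(`pieces_step_iff`). Comparing `w` with `w w` for an idempotent `w` forces `w` to be `D`-related to
a generator, and hence every regular word has a seed.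

Groups: the `R`-class of `e` is a graph whose vertices are the states reachable from the state `j₀`
of `e` and whose edges are letters. Choose a path `r j` to each vertex. An edge `j → k` with letter
`a` gets the label `η j a` in `H_e` determined by `e (r j) a = η j a · e (r k)`. As in the
Reidemeister–Schreier method, `H_e` is presented by the edges, subject to `η j a · η k b = η j c`
for basic products `a b = c` and to triviality along the chosen paths. The inverse isomorphism reads
off the label of a loop (`bijective_of_labelling`).

Algorithms: `seedRep` tests regularity and finds a canonical generator `e` in the `R`-class. Two
words in the `R`-class of `e` are equal exactly when their paths have the same end and their labels
agree in `H_e`. For part (1), actions and relators are primitive recursive in the table; the paths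
are found by unbounded search with a primitive recursive check, which makes one algorithm serve all
tables. -/

namespace BiorderedSet

/-! ### Green's relations on idempotents and the action on `L`-classes -/

section Table

variable {E : Type u} (B : BiorderedSet E)

theorem exists_embedding : ∃ (S : Type u) (_ : Semigroup S) (σ : E → S),
    Function.Injective σ ∧ (∀ s, s * s = s → ∃ e, σ e = s) ∧ (∀ e, σ e * σ e = σ e) ∧
    ∀ e f g, B.op e f = some g ↔ IsBasicPair (σ e) (σ f) ∧ σ e * σ f = σ g := by
  obtain ⟨S, i, φ, h⟩ := B.exists_semigroup
  exact ⟨S, i, fun e => (φ e : S), Subtype.val_injective.comp φ.injective,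
    fun s hs => ⟨φ.symm ⟨s, hs⟩, by simp⟩, fun e => (φ e).2, h⟩

/-- The biordered set of the opposite semigroup. -/
def opp : BiorderedSet E where
  op e f := B.op f e
  exists_semigroup := by
    obtain ⟨S, _, φ, h⟩ := B.exists_semigroup
    refine ⟨Sᵐᵒᵖ, inferInstance, φ.trans (MulOpposite.opEquiv.subtypeEquiv fun s => ?_), ?_⟩
    · rw [MulOpposite.opEquiv_apply, ← MulOpposite.op_mul, MulOpposite.op_inj]
    · intro e f g
      rw [h f e g]
      simp [IsBasicPair, Set.Nonempty, ← MulOpposite.op_mul]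
      tauto

variable {B}

/-- The definition of a basic pair is symmetric, so if the reverse product is the one equal to `x`
or `y`, then it too is recorded by `op`. -/
theorem op_cases {x y c : E} (h : B.op x y = some c) :
    c = x ∨ c = y ∨ B.op y x = some x ∨ B.op y x = some y := by
  obtain ⟨S, _, σ, inj, -, -, H⟩ := B.exists_embedding
  obtain ⟨⟨z, hz1, hz2⟩, hc⟩ := (H _ _ _).1 h
  have hyx : ∀ z, σ y * σ x = σ z → (z = x ∨ z = y) → B.op y x = some z := by
    rintro z hz (rfl | rfl) <;> exact (H _ _ _).2 ⟨⟨σ z, by simp, by simp [hz]⟩, hz⟩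
  rw [hc] at hz2
  rcases hz1 with rfl | rfl <;> rcases hz2 with hz2 | hz2
  · exact Or.inl (inj hz2.symm)
  · exact Or.inr (Or.inr (Or.inl (hyx x hz2.symm (Or.inl rfl))))
  · exact Or.inr (Or.inl (inj hz2.symm))
  · exact Or.inr (Or.inr (Or.inr (hyx y hz2.symm (Or.inr rfl))))

theorem exists_op_of_op_right {a h : E} (ha : B.op a h = some h) : ∃ g, B.op h a = some g := by
  obtain ⟨S, _, σ, inj, sur, idem, H⟩ := B.exists_embedding
  obtain ⟨-, hc⟩ := (H _ _ _).1 ha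
  obtain ⟨g, hg⟩ := sur (σ h * σ a) (by grind)
  exact ⟨g, (H _ _ _).2 ⟨⟨σ h, by simp, by simp [hc]⟩, hg.symm⟩⟩

variable (B)

/-- `f a` is `R`-related to `f` and `L`-related to `g`, witnessed by a sandwich element. -/
def ActRel (f a g : E) : Prop :=
  ∃ h, B.op f h = some f ∧ B.op h f = some h ∧ B.op a h = some h ∧ B.op h a = some g

/-- Green's relation `L` on idempotents. -/
def LRel (g k : E) : Prop := B.op g k = some g ∧ B.op k g = some k

/-- A map from `E` to a monoid which respects the products of basic pairs, and which does not
create new relations `L`, `R` or new regular products of pairs. -/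
structure IsFaithful {N : Type*} [Monoid N] (ι : E → N) : Prop where
  map_op : ∀ {e f g}, B.op e f = some g → ι e * ι f = ι g
  op_left : ∀ {e f}, ι e * ι f = ι e → B.op e f = some e
  op_right : ∀ {e f}, ι e * ι f = ι f → B.op e f = some f
  sandwich_right : ∀ {f a s}, ι f * ι a * s = ι f →
    ∃ h, B.op f h = some f ∧ B.op h f = some h ∧ B.op a h = some h
  sandwich_left : ∀ {f a s}, s * ι a * ι f = ι f →
    ∃ h, B.op h f = some f ∧ B.op f h = some h ∧ B.op h a = some h

/-- A partial right action of the letters on the `L`-classes, these being represented by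
idempotents. -/
structure IsRightAction (act : E → E → Option E) : Prop where
  spec : ∀ {f a k}, act f a = some k → ∃ g, B.ActRel f a g ∧ B.LRel g k
  isSome : ∀ {f a g}, B.ActRel f a g → (act f a).isSome = true
  canonical : ∀ {f a k f' a' k'}, act f a = some k → act f' a' = some k' → B.LRel k k' → k = k'

variable {B}

theorem IsFaithful.opp {N : Type*} [Monoid N] {ι : E → N} (h : B.IsFaithful ι) :
    B.opp.IsFaithful (fun e => MulOpposite.op (ι e)) where
  map_op H := by rw [← MulOpposite.op_mul, h.map_op H]
  op_left H := h.op_right (by simpa [← MulOpposite.op_mul] using H)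
  op_right H := h.op_left (by simpa [← MulOpposite.op_mul] using H)
  sandwich_right {f a s} H := h.sandwich_left (s := s.unop) (by
    have := congrArg MulOpposite.unop H
    simpa [mul_assoc] using this)
  sandwich_left {f a s} H := h.sandwich_right (s := s.unop) (by
    have := congrArg MulOpposite.unop H
    simpa [mul_assoc] using this)

-- An identity is adjoined so that Green's relations, which refer to `S¹`, become divisibility in a
-- monoid.
variable (B) in
theorem exists_faithful : ∃ (S : Type u) (_ : Semigroup S) (σ : E → WithOne S),
    B.IsFaithful σ := by
  obtain ⟨S, _, σ, inj, sur, idem, H⟩ := B.exists_embedding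
  have left : ∀ {e f}, σ e * σ f = σ e → B.op e f = some e := fun {e f} h =>
    (H _ _ _).2 ⟨⟨σ e, by simp, by rw [h]; simp⟩, h⟩
  have right : ∀ {e f}, σ e * σ f = σ f → B.op e f = some f := fun {e f} h =>
    (H _ _ _).2 ⟨⟨σ f, by simp, by rw [h]; simp⟩, h⟩
  refine ⟨S, inferInstance, fun e => (σ e : WithOne S), ?_, ?_, ?_, ?_, ?_⟩
  · intro e f g h
    rw [← WithOne.coe_mul, ((H _ _ _).1 h).2]
  · intro e f h
    exact left (by exact_mod_cast h)
  · intro e f h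
    exact right (by exact_mod_cast h)
  · intro f a s h
    obtain ⟨s', hs'⟩ : ∃ s' : S, σ f * σ a * s' = σ f := by
      cases s with
      | one =>
        -- If the cofactor is the adjoined identity, the idempotent `f` itself serves as a cofactor
        -- in `S`.
        refine ⟨σ f, ?_⟩
        rw [mul_one] at h
        have : σ f * σ a = σ f := by exact_mod_cast h
        rw [this, idem]
      | coe s => exact ⟨s, by exact_mod_cast h⟩
    have := idem f
    have := idem a
    -- From `f a s = f` it follows that `a s f` is idempotent, so it comes from `E`; it is the
    -- sandwich element.
    obtain ⟨k, hk⟩ := sur (σ a * s' * σ f) (by grind)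
    exact ⟨k, left (by grind), left (by grind), right (by grind)⟩
  · intro f a s h
    obtain ⟨s', hs'⟩ : ∃ s' : S, s' * σ a * σ f = σ f := by
      cases s with
      | one =>
        refine ⟨σ f, ?_⟩
        rw [one_mul] at h
        have : σ a * σ f = σ f := by exact_mod_cast h
        rw [mul_assoc, this, idem]
      | coe s => exact ⟨s, by exact_mod_cast h⟩
    have := idem f
    have := idem a
    obtain ⟨k, hk⟩ := sur (σ f * s' * σ a) (by grind)
    exact ⟨k, right (by grind), right (by grind), left (by grind)⟩

section Action

variable {N : Type*} [Monoid N] {ι : E → N} (hι : B.IsFaithful ι)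
include hι

theorem IsFaithful.idem (e : E) : ι e * ι e = ι e := hι.map_op (B.op_self e)

theorem IsFaithful.lRel_iff {g k : E} : B.LRel g k ↔ ι g * ι k = ι g ∧ ι k * ι g = ι k :=
  ⟨fun h => ⟨hι.map_op h.1, hι.map_op h.2⟩, fun h => ⟨hι.op_left h.1, hι.op_left h.2⟩⟩

theorem IsFaithful.actRel {f a g : E} (h : B.ActRel f a g) :
    ∃ k, ι f * ι a * ι k = ι f ∧ ι f * ι g = ι f * ι a ∧ ι k * ι f * ι a = ι g := by
  obtain ⟨k, h1, h2, h3, h4⟩ := h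
  have h1 := hι.map_op h1
  have h2 := hι.map_op h2
  have h3 := hι.map_op h3
  have h4 := hι.map_op h4
  exact ⟨k, by grind, by grind, by grind⟩

theorem IsFaithful.exists_actRel {f a : E} {s : N} (h : ι f * ι a * s = ι f) :
    ∃ g, B.ActRel f a g := by
  obtain ⟨k, h1, h2, h3⟩ := hι.sandwich_right h
  obtain ⟨g, hg⟩ := exists_op_of_op_right h3
  exact ⟨g, k, h1, h2, h3, hg⟩

variable {act : E → E → Option E} (hact : B.IsRightAction act)
include hact

theorem IsFaithful.act_eq {f a k : E} (h : act f a = some k) :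
    ∃ x t, ι f * ι a * x = ι f ∧ ι f * ι a * ι k = ι f * ι a ∧ t * ι f * ι a = ι k := by
  obtain ⟨g, h1, h2⟩ := hact.spec h
  obtain ⟨h, h3, h4, h5⟩ := hι.actRel h1
  obtain ⟨h6, h7⟩ := hι.lRel_iff.1 h2
  exact ⟨ι h, ι k * ι h, h3, by grind, by grind⟩

theorem IsFaithful.isSome_act {f a : E} {s : N} (h : ι f * ι a * s = ι f) :
    (act f a).isSome = true := by
  obtain ⟨g, hg⟩ := hι.exists_actRel h
  exact hact.isSome hg

/-- A path from `f` spelled by `w` witnesses `f w R f`, and its end is an idempotent `L`-related to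
`f w`. The cofactors multiply along the path. -/
theorem IsFaithful.foldlM {w : List E} {f j : E} (h : w.foldlM act f = some j) :
    ∃ x t, ι f * (w.map ι).prod * x = ι f ∧
      ι f * (w.map ι).prod * ι j = ι f * (w.map ι).prod ∧ t * ι f * (w.map ι).prod = ι j := by
  induction w generalizing f with
  | nil =>
    obtain rfl : f = j := by simpa using h
    have := hι.idem f
    exact ⟨1, 1, by simp, by simpa, by simp⟩
  | cons a w ih =>
    rw [List.foldlM_cons] at h
    obtain ⟨k, hk, h⟩ := Option.bind_eq_some_iff.1 h
    obtain ⟨x, t, h1, h2, h3⟩ := hι.act_eq hact hk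
    obtain ⟨x', t', h1', h2', h3'⟩ := ih h
    rw [List.map_cons, List.prod_cons]
    exact ⟨x' * x, t' * t, by grind, by grind, by grind⟩

theorem IsFaithful.exists_foldlM {w : List E} {f : E} {s : N}
    (h : ι f * (w.map ι).prod * s = ι f) : ∃ j, w.foldlM act f = some j := by
  induction w generalizing f s with
  | nil => exact ⟨f, rfl⟩
  | cons a w ih =>
    rw [List.map_cons, List.prod_cons] at h
    obtain ⟨k, hk⟩ := Option.isSome_iff_exists.1
      (hι.isSome_act hact (f := f) (a := a) (s := (w.map ι).prod * s) (by grind))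
    obtain ⟨x, t, h1, h2, h3⟩ := hι.act_eq hact hk
    -- Since `k = t f a`, multiplying `f a w s = f` by `t` on the left and by `a` on the right gives
    -- `k w (s a) = k`.
    obtain ⟨j, hj⟩ := ih (f := k) (s := s * ι a) (by have := congrArg (t * ·) h; grind)
    exact ⟨j, by rw [List.foldlM_cons, hk]; exact hj⟩

end Action

/-- In a faithful image, `j a b` and `j c` are the same element, so both sides are defined together.
Their ends are `L`-related values of `act`, hence equal by `canonical`. -/
theorem IsRightAction.bind_eq {act : E → E → Option E} (hact : B.IsRightAction act)
    {a b c : E} (hc : B.op a b = some c) (j : E) :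
    ((act j a).bind fun k => act k b) = act j c := by
  obtain ⟨S, _, σ, hσ⟩ := B.exists_faithful
  have hab := hσ.map_op hc
  have key : ((act j a).bind fun k => act k b) = [a, b].foldlM act j := by simp
  rw [key]
  cases hw : [a, b].foldlM act j with
  | some l =>
    obtain ⟨x, t, h1, h2, h3⟩ := hσ.foldlM hact hw
    simp only [List.map_cons, List.map_nil, List.prod_cons, List.prod_nil, mul_one] at h1 h2 h3
    obtain ⟨l', hl'⟩ := Option.isSome_iff_exists.1
      (hσ.isSome_act hact (f := j) (a := c) (s := x) (by grind))
    obtain ⟨x', t', h1', h2', h3'⟩ := hσ.act_eq hact hl'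
    rw [hl']
    obtain ⟨m, -, hm⟩ := Option.bind_eq_some_iff.1 (key.trans hw)
    rw [hact.canonical hm hl' (hσ.lRel_iff.2 ⟨by grind, by rw [← h3']; grind⟩)]
  | none =>
    cases h : act j c with
    | none => rfl
    | some l =>
      obtain ⟨x, t, h1, h2, h3⟩ := hσ.act_eq hact h
      obtain ⟨j', hj'⟩ := hσ.exists_foldlM hact (w := [a, b]) (f := j) (s := x) (by
        simp; grind)
      rw [hw] at hj'
      cases hj'

end Table

/-! ### Invariants of words under rewriting -/

section Words

variable {E : Type u} {B : BiorderedSet E}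

theorem value_nil : B.value [] = 1 := rfl

theorem value_cons (a : E) (w : List E) : B.value (a :: w) = B.of a * B.value w := rfl

theorem value_append (u v : List E) : B.value (u ++ v) = B.value u * B.value v := by
  simp [value]

theorem of_mul_of {x y c : E} (h : B.op x y = some c) : B.of x * B.of y = B.of c :=
  (Con.eq (conGen B.Rel)).2 (ConGen.Rel.of _ _ (Rel.basic x y c h))

/-- The letters of an element of the free semigroup. -/
def letters (x : FreeSemigroup E) : List E := x.head :: x.tail

theorem letters_mul (x y : FreeSemigroup E) : letters (x * y) = letters x ++ letters y := rfl

theorem value_letters (x : FreeSemigroup E) :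
    B.value (letters x) = WithOne.coe (α := B.IG) (x : (conGen B.Rel).Quotient) := by
  induction x using FreeSemigroup.recOnMul with
  | ih1 x => rfl
  | ih2 x y hx hy =>
    rw [letters_mul, value_append, hy]
    erw [hx]
    rfl

theorem exists_value_eq (x : WithOne B.IG) : ∃ w, B.value w = x := by
  cases x with
  | one => exact ⟨[], rfl⟩
  | coe x =>
    obtain ⟨y, rfl⟩ := Quotient.exists_rep x
    exact ⟨letters y, value_letters y⟩

theorem value_eq_one_iff {w : List E} : B.value w = 1 ↔ w = [] := by
  constructor
  · cases w with
    | nil => simp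
    | cons a w =>
      intro h
      have := value_letters (B := B) ⟨a, w⟩
      rw [letters, h] at this
      exact (WithOne.coe_ne_one this.symm).elim
  · rintro rfl; rfl

/-- A property of words which is invariant under the elementary rewriting steps only depends on the
value of the word. -/
theorem iff_of_value_eq {P : List E → Prop}
    (hP : ∀ u v x y c, B.op x y = some c → (P (u ++ x :: y :: v) ↔ P (u ++ c :: v)))
    {w w' : List E} (h : B.value w = B.value w') : P w ↔ P w' := by
  have key : ∀ x y : FreeSemigroup E, conGen B.Rel x y →
      ∀ u v, P (u ++ (letters x ++ v)) ↔ P (u ++ (letters y ++ v)) := by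
    intro x y hxy
    induction hxy with
    | of x y h =>
      intro u v
      obtain ⟨e, f, g, h⟩ := h
      exact hP u v e f g h
    | refl x => exact fun u v => Iff.rfl
    | symm _ ih => exact fun u v => (ih u v).symm
    | trans _ _ ih1 ih2 => exact fun u v => (ih1 u v).trans (ih2 u v)
    | mul _ _ ih1 ih2 =>
      intro u v
      rw [letters_mul, letters_mul]
      simp only [List.append_assoc]
      rw [ih1 u, ← List.append_assoc, ih2, List.append_assoc]
  cases w with
  | nil =>
    rw [value_nil, eq_comm, value_eq_one_iff] at h
    rw [h]
  | cons a w =>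
    cases w' with
    | nil =>
      rw [value_nil, value_eq_one_iff] at h
      rw [h]
    | cons a' w' =>
      have h1 := value_letters (B := B) ⟨a, w⟩
      have h2 := value_letters (B := B) ⟨a', w'⟩
      rw [letters] at h1 h2
      rw [h1, h2] at h
      have := key _ _ ((Con.eq _).1 (WithOne.coe_injective h)) [] []
      simpa [letters] using this

theorem prod_eq_of_value_eq {N : Type*} [Monoid N] {ι : E → N}
    (hι : ∀ {e f g}, B.op e f = some g → ι e * ι f = ι g) {w w' : List E}
    (h : B.value w = B.value w') : (w.map ι).prod = (w'.map ι).prod :=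
  ((iff_of_value_eq (P := fun w => (w.map ι).prod = (w'.map ι).prod) (by
    intro u v x y c hc
    simp [← hι hc, mul_assoc]) h).2 rfl)

theorem foldlM_eq_of_value_eq {X : Type*} {step : X → E → Option X}
    (hs : ∀ {a b c}, B.op a b = some c → ∀ x, ((step x a).bind fun y => step y b) = step x c)
    {w w' : List E} (h : B.value w = B.value w') (x : X) : w.foldlM step x = w'.foldlM step x :=
  ((iff_of_value_eq (P := fun w => w.foldlM step x = w'.foldlM step x) (by
    intro u v a b c hc
    have : ∀ y, (a :: b :: v).foldlM step y = (c :: v).foldlM step y := by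
      intro y
      rw [List.foldlM_cons, List.foldlM_cons, ← hs hc]
      cases step y a <;> rfl
    simp only [List.foldlM_append, this]) h).2 rfl)

variable (B) in
/-- The image of a letter in the free idempotent generated semigroup with an identity adjoined. -/
def gen (e : E) : WithOne B.IG := (B.of e : WithOne B.IG)

theorem prod_gen (w : List E) : (w.map B.gen).prod = B.value w := rfl

-- Any equation in `IG` maps to one in `S`, where faithfulness is known; the sandwich element found
-- there lies in `E`.
variable (B) in
theorem isFaithful_gen : B.IsFaithful B.gen := by
  obtain ⟨S, _, σ, hσ⟩ := B.exists_faithful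
  have key : ∀ {w w' : List E}, (w.map B.gen).prod = (w'.map B.gen).prod →
      (w.map σ).prod = (w'.map σ).prod := prod_eq_of_value_eq hσ.map_op
  refine ⟨?_, ?_, ?_, ?_, ?_⟩
  · intro e f g h
    rw [gen, gen, ← WithOne.coe_mul, of_mul_of h]; rfl
  · intro e f h
    have := key (w := [e, f]) (w' := [e]) (by simpa using h)
    exact hσ.op_left (by simpa using this)
  · intro e f h
    have := key (w := [e, f]) (w' := [f]) (by simpa using h)
    exact hσ.op_right (by simpa using this)
  · intro f a s h
    obtain ⟨w, rfl⟩ := exists_value_eq s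
    have := key (w := f :: a :: w) (w' := [f]) (by simpa [prod_gen, mul_assoc] using h)
    exact hσ.sandwich_right (a := a) (f := f) (s := (w.map σ).prod)
      (by simpa [mul_assoc] using this)
  · intro f a s h
    obtain ⟨w, rfl⟩ := exists_value_eq s
    have := key (w := w ++ [a, f]) (w' := [f]) (by simpa [prod_gen, mul_assoc] using h)
    exact hσ.sandwich_left (a := a) (f := f) (s := (w.map σ).prod)
      (by simpa [mul_assoc] using this)

end Words

end BiorderedSet

/-! ### Seeds, seeded factorizations and regular elements -/

namespace BiorderedSet

variable {E : Type u}

theorem lRel_equivalence (B : BiorderedSet E) : Equivalence B.LRel := by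
  obtain ⟨S, _, σ, hσ⟩ := B.exists_faithful
  refine ⟨fun e => ⟨B.op_self e, B.op_self e⟩, fun h => ⟨h.2, h.1⟩, fun h h' => ?_⟩
  rw [hσ.lRel_iff] at *
  exact ⟨by grind, by rw [← h'.2, mul_assoc, h.2]⟩

theorem exists_isRightAction (B : BiorderedSet E) : ∃ act, B.IsRightAction act := by
  classical
  let s : Setoid E := ⟨B.LRel, B.lRel_equivalence⟩
  refine ⟨fun f a => if h : ∃ g, B.ActRel f a g then some (Quotient.mk s h.choose).out else none,
    ?_, ?_, ?_⟩
  · intro f a k hk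
    split_ifs at hk with h
    obtain rfl := Option.some.inj hk
    exact ⟨h.choose, h.choose_spec, s.symm (Quotient.mk_out (s := s) h.choose)⟩
  · intro f a g hg
    rw [dif_pos ⟨g, hg⟩]
    rfl
  · intro f a k f' a' k' hk hk' hkk
    split_ifs at hk hk' with h h'
    obtain rfl := Option.some.inj hk
    obtain rfl := Option.some.inj hk'
    have := Quotient.sound (s := s) hkk
    rw [Quotient.out_eq, Quotient.out_eq] at this
    rw [this]

variable {B : BiorderedSet E}

theorem prod_op_gen (w : List E) :
    (w.map fun e => MulOpposite.op (B.gen e)).prod = MulOpposite.op (B.value w.reverse) := by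
  induction w with
  | nil => rfl
  | cons a w ih =>
    rw [List.map_cons, List.prod_cons, ih, List.reverse_cons, value_append, MulOpposite.op_mul]
    rfl

/-- If `f w` is `R`-related to `f`, then it is `L`-related to an idempotent of `E`. -/
theorem exists_gen_of_greenR {f : E} {w : List E} {s : WithOne B.IG}
    (h : B.gen f * B.value w * s = B.gen f) :
    ∃ g t, B.gen f * B.value w * B.gen g = B.gen f * B.value w ∧
      t * B.gen f * B.value w = B.gen g := by
  obtain ⟨act, hact⟩ := B.exists_isRightAction
  obtain ⟨j, hj⟩ := B.isFaithful_gen.exists_foldlM hact h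
  obtain ⟨x, t, -, h2, h3⟩ := B.isFaithful_gen.foldlM hact hj
  exact ⟨j, t, h2, h3⟩

/-- If `w f` is `L`-related to `f`, then it is `R`-related to an idempotent of `E`. -/
theorem exists_gen_of_greenL {f : E} {w : List E} {s : WithOne B.IG}
    (h : s * B.value w * B.gen f = B.gen f) :
    ∃ g t, B.gen g * (B.value w * B.gen f) = B.value w * B.gen f ∧
      B.value w * B.gen f * t = B.gen g := by
  obtain ⟨act, hact⟩ := B.opp.exists_isRightAction
  have hf := B.isFaithful_gen.opp
  have h' := congrArg MulOpposite.op h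
  obtain ⟨j, hj⟩ := hf.exists_foldlM hact (f := f) (w := w.reverse) (s := MulOpposite.op s) (by
    rw [prod_op_gen, List.reverse_reverse]
    simpa [mul_assoc] using h')
  obtain ⟨x, t, -, h2, h3⟩ := hf.foldlM hact hj
  rw [prod_op_gen, List.reverse_reverse] at h2 h3
  refine ⟨j, t.unop, ?_, ?_⟩
  · simpa [mul_assoc] using congrArg MulOpposite.unop h2
  · simpa [mul_assoc] using congrArg MulOpposite.unop h3

theorem gen_mul_self (e : E) : B.gen e * B.gen e = B.gen e := B.isFaithful_gen.idem e

theorem value_cons' (a : E) (w : List E) : B.value (a :: w) = B.gen a * B.value w := rfl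

theorem value_singleton (a : E) : B.value [a] = B.gen a := by
  rw [value_cons', value_nil, mul_one]

variable (B) in
/-- A word `u f v` such that `u f` is `L`-related to `f` and `f v` is `R`-related to `f`. -/
def HasSeed (w : List E) : Prop :=
  ∃ u f v x y, w = u ++ f :: v ∧ x * B.value u * B.gen f = B.gen f ∧
    B.gen f * B.value v * y = B.gen f

theorem _root_.List.append_eq_append_cons_iff {α : Type*} {u r u₁ v₁ : List α} {f : α} :
    u ++ r = u₁ ++ f :: v₁ ↔
      (∃ m, u = u₁ ++ f :: m ∧ v₁ = m ++ r) ∨ ∃ m, u₁ = u ++ m ∧ r = m ++ f :: v₁ := by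
  rw [List.append_eq_append_iff]
  constructor
  · rintro (⟨m, h1, h2⟩ | ⟨m, h1, h2⟩)
    · exact Or.inr ⟨m, h1, h2⟩
    · cases m with
      | nil => exact Or.inr ⟨[], by simpa using h1.symm, by simpa using h2.symm⟩
      | cons a m =>
        simp only [List.cons_append, List.cons.injEq] at h2
        exact Or.inl ⟨m, by rw [h1, h2.1], h2.2⟩
  · rintro (⟨m, h1, h2⟩ | ⟨m, h1, h2⟩)
    · exact Or.inr ⟨f :: m, h1, by simp [h2]⟩
    · exact Or.inl ⟨m, h1, h2⟩

theorem hasSeed_singleton (a : E) : B.HasSeed [a] :=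
  ⟨[], a, [], 1, 1, rfl, by simp [value_nil], by simp [value_nil]⟩

theorem not_hasSeed_nil : ¬ B.HasSeed [] := by
  rintro ⟨u, f, v, x, y, h, -⟩
  simp at h

/-- A seed away from the rewritten letters survives because values do not change. If `x` or `y` is a
seed, then `c` becomes one. If `c` is a seed, then the form of the basic pair makes `x` or `y` a
seed. -/
theorem hasSeed_step_iff {u v : List E} {x y c : E} (hc : B.op x y = some c) :
    B.HasSeed (u ++ x :: y :: v) ↔ B.HasSeed (u ++ c :: v) := by
  have hxy := B.isFaithful_gen.map_op hc
  have hx := gen_mul_self (B := B) x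
  have hy := gen_mul_self (B := B) y
  have hv : B.value (x :: y :: v) = B.value (c :: v) := by
    rw [value_cons', value_cons', value_cons', ← hxy, mul_assoc]
  constructor
  · rintro ⟨u₁, f, v₁, s, t, hw, h1, h2⟩
    rcases List.append_eq_append_cons_iff.1 hw with ⟨m, rfl, rfl⟩ | ⟨m, rfl, hm⟩
    · refine ⟨u₁, f, m ++ c :: v, s, t, by simp, h1, ?_⟩
      rwa [value_append, ← hv, ← value_append]
    · rcases m with _ | ⟨a, _ | ⟨b, m⟩⟩
      · simp only [List.nil_append, List.cons.injEq] at hm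
        obtain ⟨rfl, rfl⟩ := hm
        rw [List.append_nil] at h1
        rw [value_cons'] at h2
        refine ⟨u, c, v, s, t * B.gen c, rfl, ?_, ?_⟩
        · rw [← hxy]; grind
        · rw [← hxy]; grind
      · simp only [List.cons_append, List.nil_append, List.cons.injEq] at hm
        obtain ⟨rfl, rfl, rfl⟩ := hm
        rw [value_append, value_singleton] at h1
        refine ⟨u, c, v, B.gen c * s, t, rfl, ?_, ?_⟩
        · rw [← hxy]; grind
        · rw [← hxy]; grind
      · simp only [List.cons_append, List.cons.injEq] at hm
        obtain ⟨rfl, rfl, rfl⟩ := hm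
        refine ⟨u ++ c :: m, f, v₁, s, t, by simp, ?_, h2⟩
        simp only [value_append, value_cons', ← hxy, mul_assoc] at h1 ⊢
        exact h1
  · rintro ⟨u₁, f, v₁, s, t, hw, h1, h2⟩
    rcases List.append_eq_append_cons_iff.1 hw with ⟨m, rfl, rfl⟩ | ⟨m, rfl, hm⟩
    · refine ⟨u₁, f, m ++ x :: y :: v, s, t, by simp, h1, ?_⟩
      rwa [value_append, hv, ← value_append]
    · rcases m with _ | ⟨a, m⟩
      · simp only [List.nil_append, List.cons.injEq] at hm
        obtain ⟨rfl, rfl⟩ := hm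
        rw [List.append_nil] at h1
        -- If `y x = x`, then `c R x` and `x` inherits the seed; if `y x = y`, then `c L y` and `y`
        -- does.
        rcases op_cases hc with rfl | rfl | hyx | hyx
        · refine ⟨u, c, y :: v, s, t, rfl, h1, ?_⟩
          rw [value_cons']; grind
        · refine ⟨u ++ [x], c, v, s, t, by simp, ?_, h2⟩
          rw [value_append, value_singleton]; grind
        · have hyx := B.isFaithful_gen.map_op hyx
          refine ⟨u, x, y :: v, s, t * B.gen x, rfl, ?_, ?_⟩
          · have := congrArg (· * B.gen x) h1
            simp only [← hxy] at this
            grind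
          · rw [value_cons']
            have : B.gen x * (B.gen y * B.value v) * t = B.gen c := by
              rw [← h2, ← hxy]; simp only [mul_assoc]
            grind
        · have hyx := B.isFaithful_gen.map_op hyx
          refine ⟨u ++ [x], y, v, B.gen y * s, t, by simp, ?_, ?_⟩
          · rw [value_append, value_singleton]
            have : s * (B.value u * B.gen x) * B.gen y = B.gen c := by
              rw [← h1, ← hxy]; simp only [mul_assoc]
            grind
          · have := congrArg (B.gen y * ·) h2
            simp only [← hxy] at this
            grind
      · simp only [List.cons_append, List.cons.injEq] at hm
        obtain ⟨rfl, rfl⟩ := hm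
        refine ⟨u ++ x :: y :: m, f, v₁, s, t, by simp, ?_, h2⟩
        simp only [value_append, value_cons', ← hxy, mul_assoc] at h1 ⊢
        exact h1

variable (B) in
/-- The word `w` is a product of at most `k` words with a seed. -/
inductive Pieces : ℕ → List E → Prop
  | nil (k : ℕ) : Pieces k []
  | cons {k : ℕ} {p w : List E} : B.HasSeed p → Pieces k w → Pieces (k + 1) (p ++ w)

theorem Pieces.mono {k l : ℕ} {w : List E} (h : B.Pieces k w) (hkl : k ≤ l) : B.Pieces l w := by
  induction h generalizing l with
  | nil k => exact .nil l
  | cons hp _ ih =>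
    obtain ⟨l, rfl⟩ := Nat.exists_eq_add_of_le' (Nat.one_le_of_lt hkl)
    exact .cons hp (ih (by omega))

theorem Pieces.append {k l : ℕ} {w w' : List E} (h : B.Pieces k w) (h' : B.Pieces l w') :
    B.Pieces (k + l) (w ++ w') := by
  induction h with
  | nil k => exact h'.mono (by omega)
  | cons hp _ ih =>
    rw [List.append_assoc, Nat.add_right_comm]
    exact .cons hp ih

theorem HasSeed.pieces {w : List E} (h : B.HasSeed w) : B.Pieces 1 w := by
  simpa using Pieces.cons h (.nil 0)

theorem pieces_length (w : List E) : B.Pieces w.length w := by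
  induction w with
  | nil => exact .nil 0
  | cons a w ih => exact .cons (hasSeed_singleton a) ih

theorem Pieces.eq_nil {w : List E} (h : B.Pieces 0 w) : w = [] := by
  cases h
  rfl

theorem Pieces.exists_piece {k : ℕ} {u v : List E} {c : E} (h : B.Pieces k (u ++ c :: v)) :
    ∃ i j u₁ u₂ v₁ v₂, i + 1 + j = k ∧ u = u₁ ++ u₂ ∧ v = v₁ ++ v₂ ∧ B.Pieces i u₁ ∧
      B.Pieces j v₂ ∧ B.HasSeed (u₂ ++ c :: v₁) := by
  generalize hw : u ++ c :: v = w at h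
  induction h generalizing u with
  | nil k => simp at hw
  | @cons k p w hp hw' ih =>
    rcases List.append_eq_append_cons_iff.1 hw.symm with ⟨m, rfl, rfl⟩ | ⟨m, rfl, rfl⟩
    · exact ⟨0, k, [], u, m, w, by omega, rfl, rfl, .nil 0, hw', hp⟩
    · obtain ⟨i, j, u₁, u₂, v₁, v₂, hk, rfl, rfl, h1, h2, h3⟩ := ih rfl
      exact ⟨i + 1, j, p ++ u₁, u₂, v₁, v₂, by omega, by simp, rfl, .cons hp h1, h2, h3⟩

theorem Pieces.split {k : ℕ} {a b : List E} (h : B.Pieces k (a ++ b)) :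
    (∃ i j, i + j = k ∧ B.Pieces i a ∧ B.Pieces j b) ∨
    ∃ i j a₁ a₂ b₁ b₂, i + 1 + j = k ∧ a = a₁ ++ a₂ ∧ b = b₁ ++ b₂ ∧ a₂ ≠ [] ∧ b₁ ≠ [] ∧
      B.Pieces i a₁ ∧ B.Pieces j b₂ ∧ B.HasSeed (a₂ ++ b₁) := by
  rcases b with _ | ⟨c, v⟩
  · rw [List.append_nil] at h
    exact Or.inl ⟨k, 0, rfl, h, .nil 0⟩
  · obtain ⟨i, j, u₁, u₂, v₁, v₂, hk, rfl, rfl, h1, h2, h3⟩ := h.exists_piece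
    rcases eq_or_ne u₂ [] with rfl | hu
    · refine Or.inl ⟨i, 1 + j, by omega, by simpa using h1, ?_⟩
      simpa using HasSeed.pieces h3 |>.append h2
    · exact Or.inr ⟨i, j, u₁, u₂, c :: v₁, v₂, hk, rfl, rfl, hu, by simp, h1, h2, h3⟩

/-- If the seed of `y v` is `y` itself, the seed of `u x` extends over `v`. Otherwise it lies in
`v`, which is then seeded without `y`. -/
theorem pieces_two_left {u v : List E} {x y : E} (hx : B.HasSeed (u ++ [x]))
    (hy : B.HasSeed (y :: v)) (hxy : B.gen x * B.gen y = B.gen x) :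
    B.Pieces 2 (u ++ x :: v) := by
  obtain ⟨u', f, v', s, t, hw, h1, h2⟩ := hy
  rcases u' with _ | ⟨a, u'⟩
  · simp only [List.nil_append, List.cons.injEq] at hw
    obtain ⟨rfl, rfl⟩ := hw
    refine HasSeed.pieces ?_ |>.mono (l := 2) (by omega)
    obtain ⟨u', f, v', s', t', hw, h1', h2'⟩ := hx
    rcases List.append_eq_append_cons_iff.1 hw with ⟨m, rfl, rfl⟩ | ⟨m, rfl, hm⟩
    · refine ⟨u', f, m ++ x :: v, s', t * t', by simp, h1', ?_⟩
      simp only [value_append, value_cons', value_nil, mul_one] at h2' ⊢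
      grind
    · rcases m with _ | ⟨b, m⟩
      · simp only [List.nil_append, List.cons.injEq] at hm
        obtain ⟨rfl, rfl⟩ := hm
        refine ⟨u, x, v, s', t, rfl, by simpa using h1', ?_⟩
        grind
      · simp at hm
  · simp only [List.cons_append, List.cons.injEq] at hw
    obtain ⟨rfl, rfl⟩ := hw
    have : B.HasSeed (u' ++ f :: v') := by
      refine ⟨u', f, v', s * B.gen y, t, rfl, ?_, h2⟩
      rw [value_cons'] at h1
      grind
    simpa using hx.pieces.append this.pieces

theorem pieces_two_right {u v : List E} {x y : E} (hx : B.HasSeed (u ++ [x]))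
    (hy : B.HasSeed (y :: v)) (hxy : B.gen x * B.gen y = B.gen y) :
    B.Pieces 2 (u ++ y :: v) := by
  obtain ⟨u', f, v', s, t, hw, h1, h2⟩ := hx
  rcases List.append_eq_append_cons_iff.1 hw with ⟨m, rfl, rfl⟩ | ⟨m, rfl, hm⟩
  · have : B.HasSeed (u' ++ f :: m) := by
      refine ⟨u', f, m, s, B.gen x * t, rfl, h1, ?_⟩
      rw [value_append, value_singleton] at h2
      grind
    exact this.pieces.append hy.pieces
  · rcases m with _ | ⟨b, m⟩
    · simp only [List.nil_append, List.cons.injEq] at hm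
      obtain ⟨rfl, rfl⟩ := hm
      rw [List.append_nil] at h1
      refine HasSeed.pieces ?_ |>.mono (l := 2) (by omega)
      obtain ⟨u', f, v', s', t', hw, h1', h2'⟩ := hy
      rcases u' with _ | ⟨a, u'⟩
      · simp only [List.nil_append, List.cons.injEq] at hw
        obtain ⟨rfl, rfl⟩ := hw
        refine ⟨u, y, v, s, t', rfl, ?_, h2'⟩
        have : s * B.value u * B.gen x * B.gen y = B.gen x * B.gen y := by rw [h1]
        grind
      · simp only [List.cons_append, List.cons.injEq] at hw
        obtain ⟨rfl, rfl⟩ := hw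
        refine ⟨u ++ y :: u', f, v', s' * s, t', by simp, ?_, h2'⟩
        have : s * B.value u * B.gen x * B.gen y = B.gen x * B.gen y := by rw [h1]
        simp only [value_append, value_cons'] at h1' ⊢
        grind
    · simp at hm

theorem HasSeed.congr_last {u : List E} {x c : E} (h : B.HasSeed (u ++ [x]))
    (hcx : B.gen c * B.gen x = B.gen x) (hxc : B.gen x * B.gen c = B.gen c) :
    B.HasSeed (u ++ [c]) := by
  obtain ⟨u', f, v', s, t, hw, h1, h2⟩ := h
  rcases List.append_eq_append_cons_iff.1 hw with ⟨m, rfl, rfl⟩ | ⟨m, rfl, hm⟩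
  · refine ⟨u', f, m ++ [c], s, B.gen x * t, by simp, h1, ?_⟩
    rw [value_append, value_singleton] at *
    grind
  · rcases m with _ | ⟨b, m⟩
    · simp only [List.nil_append, List.cons.injEq] at hm
      obtain ⟨rfl, rfl⟩ := hm
      rw [List.append_nil] at h1
      refine ⟨u, c, [], s, 1, rfl, ?_, by simp [value_nil]⟩
      rw [← hxc, ← mul_assoc, h1]
    · simp at hm

theorem HasSeed.congr_head {v : List E} {y c : E} (h : B.HasSeed (y :: v))
    (hyc : B.gen y * B.gen c = B.gen y) (hcy : B.gen c * B.gen y = B.gen c) :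
    B.HasSeed (c :: v) := by
  obtain ⟨u', f, v', s, t, hw, h1, h2⟩ := h
  rcases u' with _ | ⟨a, u'⟩
  · simp only [List.nil_append, List.cons.injEq] at hw
    obtain ⟨rfl, rfl⟩ := hw
    refine ⟨[], c, v, 1, t * B.gen c, rfl, by simp [value_nil], ?_⟩
    have : B.gen c * (B.gen y * B.value v * t) = B.gen c * B.gen y := by rw [h2]
    grind
  · simp only [List.cons_append, List.cons.injEq] at hw
    obtain ⟨rfl, rfl⟩ := hw
    refine ⟨c :: u', f, v', s * B.gen y, t, rfl, ?_, h2⟩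
    rw [value_cons'] at *
    grind

/-- Contracting two letters on either side of a cut must not increase the number of pieces. When
neither `c = x` nor `c = y`, one has `c R x` or `c L y`, and replacing that letter by `c` reduces to
the absorbing cases. -/
theorem pieces_two {u v : List E} {x y c : E} (hx : B.HasSeed (u ++ [x]))
    (hy : B.HasSeed (y :: v)) (hc : B.op x y = some c) : B.Pieces 2 (u ++ c :: v) := by
  have hxy := B.isFaithful_gen.map_op hc
  have hxx := gen_mul_self (B := B) x
  have hyy := gen_mul_self (B := B) y
  rcases op_cases hc with rfl | rfl | hyx | hyx
  · exact pieces_two_left hx hy hxy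
  · exact pieces_two_right hx hy hxy
  · have hyx := B.isFaithful_gen.map_op hyx
    exact pieces_two_left (hx.congr_last (c := c) (by grind) (by grind)) hy (by grind)
  · have hyx := B.isFaithful_gen.map_op hyx
    exact pieces_two_right hx (hy.congr_head (c := c) (by grind) (by grind)) (by grind)

theorem pieces_step_iff {k : ℕ} {u v : List E} {x y c : E} (hc : B.op x y = some c) :
    B.Pieces k (u ++ x :: y :: v) ↔ B.Pieces k (u ++ c :: v) := by
  constructor
  · intro h
    rw [List.append_cons] at h
    -- Either a cut separates `x` from `y`, and the two adjacent pieces are handled by `pieces_two`,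
    -- or one piece contains both letters and stays seeded.
    rcases h.split with ⟨i, j, hk, h1, h2⟩ | ⟨i, j, a₁, a₂, b₁, b₂, hk, ha, hb, ha₂, hb₁, h1, h2, h3⟩
    · obtain ⟨i₁, j₁, u₁, u₂, v₁, v₂, hi, rfl, hv, p1, -, p3⟩ := h1.exists_piece
      obtain ⟨rfl, rfl⟩ := List.append_eq_nil_iff.1 hv.symm
      obtain ⟨i₂, j₂, u₃, u₄, v₃, v₄, hj, hu, rfl, -, q2, q3⟩ :=
        Pieces.exists_piece (u := []) h2
      obtain ⟨rfl, rfl⟩ := List.append_eq_nil_iff.1 hu.symm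
      have := (p1.append (pieces_two p3 q3 hc)).append q2
      simp only [List.append_assoc, List.cons_append] at this ⊢
      exact this.mono (by omega)
    · obtain ⟨a', z, rfl⟩ := List.eq_nil_or_concat' a₂ |>.resolve_left ha₂
      obtain ⟨z', b', rfl⟩ := List.exists_cons_of_ne_nil hb₁
      rw [← List.append_assoc] at ha
      obtain ⟨rfl, hz⟩ := List.append_inj' ha rfl
      simp only [List.cons.injEq, List.cons_append, and_true] at hz hb
      obtain ⟨rfl, rfl⟩ := hb
      subst hz
      rw [List.append_assoc] at h3
      have h4 := (hasSeed_step_iff hc).1 h3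
      have := (h1.append h4.pieces).append h2
      simp only [List.append_assoc, List.cons_append] at this ⊢
      exact this.mono (by omega)
  · intro h
    obtain ⟨i, j, u₁, u₂, v₁, v₂, hk, rfl, rfl, h1, h2, h3⟩ := h.exists_piece
    have h4 := (hasSeed_step_iff hc).2 h3
    have := (h1.append h4.pieces).append h2
    simp only [List.append_assoc, List.cons_append] at this ⊢
    exact this.mono (by omega)

/-- With `k` least for `w`, split `w w` into `k` pieces. A cut in the middle would give `2 k ≤ k`,
so some piece straddles it. Its seed lies in one copy, and minimality forces that piece to contain
the whole other copy. -/
theorem exists_gen_of_idempotent_aux {w : List E} (hw : w ≠ [])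
    (h : B.value w * B.value w = B.value w) :
    (∃ g x, B.value w * B.gen g = B.value w ∧ B.gen g * B.value w * x = B.gen g) ∨
    ∃ g x, B.gen g * B.value w = B.value w ∧ x * B.value w * B.gen g = B.gen g := by
  classical
  have hex : ∃ k, B.Pieces k w := ⟨_, pieces_length w⟩
  obtain ⟨k, hk, hmin⟩ : ∃ k, B.Pieces k w ∧ ∀ i, B.Pieces i w → k ≤ i :=
    ⟨Nat.find hex, Nat.find_spec hex, fun i hi => Nat.find_min' hex hi⟩
  have hk0 : k ≠ 0 := by
    rintro rfl
    exact hw hk.eq_nil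
  have hww : B.Pieces k (w ++ w) :=
    (iff_of_value_eq (P := B.Pieces k) (fun u v x y c hc => pieces_step_iff hc)
      (by rw [value_append, h])).2 hk
  rcases hww.split with ⟨i, j, hij, h1, h2⟩ | ⟨i, j, a₁, a₂, b₁, b₂, hij, ha, hb, -, -, h1, h2, h3⟩
  · have := hmin _ h1
    have := hmin _ h2
    omega
  · obtain ⟨u, f, v, x, y, h4, h5, h6⟩ := h3
    have hf := gen_mul_self (B := B) f
    rcases List.append_eq_append_cons_iff.1 h4 with ⟨m, rfl, rfl⟩ | ⟨m, rfl, rfl⟩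
    · rw [value_append] at h6
      have hs : B.HasSeed (u ++ f :: m) := ⟨u, f, m, x, B.value b₁ * y, rfl, h5, by grind⟩
      have := hmin (i + 1) (ha ▸ h1.append hs.pieces)
      obtain rfl : j = 0 := by omega
      obtain rfl := h2.eq_nil
      rw [List.append_nil] at hb
      subst hb
      -- Here `w` ends in `f m` and `f m w R f`. Thus `f m R f`, and the generator `g` in the
      -- `L`-class of `f m` satisfies `w g = w` and `g w R g`.
      obtain ⟨g, t, h7, h8⟩ := exists_gen_of_greenR (s := B.value w * y) (f := f) (w := m)
        (by grind)
      refine Or.inl ⟨g, y * B.gen f * B.value m, ?_, ?_⟩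
      · have : B.value w = B.value a₁ * B.value u * (B.gen f * B.value m) := by
          conv_lhs => rw [ha]
          simp only [value_append, value_cons', mul_assoc]
        rw [this]
        grind
      · have := congrArg (t * ·) h6
        clear ha h4
        grind
    · rw [value_append] at h5
      have hs : B.HasSeed (m ++ f :: v) := ⟨m, f, v, x * B.value a₂, y, rfl, by grind, h6⟩
      have := hmin (1 + j) (hb ▸ hs.pieces.append h2)
      obtain rfl : i = 0 := by omega
      obtain rfl := h1.eq_nil
      rw [List.nil_append] at ha
      subst ha
      obtain ⟨g, t, h7, h8⟩ := exists_gen_of_greenL (s := x * B.value w) (f := f) (w := m)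
        (by grind)
      refine Or.inr ⟨g, B.value m * B.gen f * x, ?_, ?_⟩
      · have : B.value w = B.value m * B.gen f * (B.value v * B.value b₂) := by
          conv_lhs => rw [hb]
          simp only [value_append, value_cons', mul_assoc]
        rw [this]
        grind
      · have := congrArg (· * t) h5
        clear hb h4
        grind

/-- Every idempotent of the free idempotent generated semigroup is `R`-related to a generator. -/
theorem exists_greenR_of_idempotent {w : List E} (hw : w ≠ [])
    (h : B.value w * B.value w = B.value w) :
    ∃ g x, B.gen g * B.value w = B.value w ∧ B.value w * x = B.gen g := by
  rcases exists_gen_of_idempotent_aux hw h with ⟨g, x, h1, h2⟩ | ⟨g, x, h1, h2⟩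
  · have h3 : B.gen g * B.value w = B.gen g := by
      grind
    have hg := gen_mul_self (B := B) g
    obtain ⟨g', t, h4, h5⟩ := exists_gen_of_greenL (f := g) (w := w) (s := B.gen g) (by grind)
    rw [h1] at h4 h5
    exact ⟨g', t, h4, h5⟩
  · refine ⟨g, B.gen g, h1, ?_⟩
    grind

/-- A word which represents a regular element is `R`-related to a generator. -/
theorem IsRegularWord.exists_greenR {w : List E} (h : B.IsRegularWord w) :
    ∃ g x, B.gen g * B.value w = B.value w ∧ B.value w * x = B.gen g := by
  obtain ⟨x, hx, x', hx'⟩ := h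
  obtain ⟨z, hz⟩ := exists_value_eq (x' : WithOne B.IG)
  have h1 : B.value w * B.value z * B.value w = B.value w := by
    rw [hx, hz, ← WithOne.coe_mul, ← WithOne.coe_mul, hx']
  have hw : w ≠ [] := by
    rintro rfl
    exact WithOne.one_ne_coe hx
  obtain ⟨g, y, h2, h3⟩ := exists_greenR_of_idempotent (w := w ++ z) (B := B) (by simp [hw])
    (by rw [value_append]; grind)
  rw [value_append] at h2 h3
  exact ⟨g, B.value z * y, by grind, by grind⟩

/-- If `g` is a generator in the `R`-class of `w`, the word `g w` has the same value and its first
letter is a seed; invariance carries this back to `w`. -/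
theorem IsRegularWord.hasSeed {w : List E} (h : B.IsRegularWord w) : B.HasSeed w := by
  obtain ⟨g, x, h1, h2⟩ := h.exists_greenR
  refine (iff_of_value_eq (P := B.HasSeed) (fun u v x y c hc => hasSeed_step_iff hc)
    (w := g :: w) (by rw [value_cons', h1])).1 ⟨[], g, w, 1, x, rfl, by simp [value_nil], ?_⟩
  rw [h1, h2]

end BiorderedSet

/-! ### Edge labels and the structure of the maximal subgroups -/

namespace BiorderedSet

variable {E : Type u} {B : BiorderedSet E}

section MaximalSubgroup

variable {e : E}

/-- The element of the free idempotent generated semigroup (with an identity adjoined) underlying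
an element of a maximal subgroup. -/
def MaximalSubgroup.val (h : B.MaximalSubgroup e) : WithOne B.IG :=
  WithOne.coe (α := B.IG) (Subtype.val (p := fun x => GreenH x (B.of e)) h)

theorem MaximalSubgroup.val_injective :
    Function.Injective (MaximalSubgroup.val : B.MaximalSubgroup e → WithOne B.IG) :=
  WithOne.coe_injective.comp Subtype.val_injective

theorem MaximalSubgroup.val_mul (h h' : B.MaximalSubgroup e) : (h * h').val = h.val * h'.val := rfl

theorem MaximalSubgroup.val_one : (1 : B.MaximalSubgroup e).val = B.gen e := rfl

theorem MaximalSubgroup.gen_mul_val (h : B.MaximalSubgroup e) : B.gen e * h.val = h.val := by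
  rw [← val_one, ← val_mul, one_mul]

theorem MaximalSubgroup.val_mul_gen (h : B.MaximalSubgroup e) : h.val * B.gen e = h.val := by
  rw [← val_one, ← val_mul, mul_one]

theorem MaximalSubgroup.exists_val_eq {x y z : WithOne B.IG} (h1 : B.gen e * x = x)
    (h2 : x * B.gen e = x) (h3 : x * y = B.gen e) (h4 : z * x = B.gen e) :
    ∃ h : B.MaximalSubgroup e, h.val = x := by
  have hl : ∀ x : WithOne B.IG, ∃ a : B.IG, (a : WithOne B.IG) = B.gen e * x := by
    intro x
    cases x with
    | one => exact ⟨B.of e, by rw [mul_one]; rfl⟩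
    | coe x => exact ⟨B.of e * x, rfl⟩
  have hr : ∀ x : WithOne B.IG, ∃ a : B.IG, (a : WithOne B.IG) = x * B.gen e := by
    intro x
    cases x with
    | one => exact ⟨B.of e, by rw [one_mul]; rfl⟩
    | coe x => exact ⟨x * B.of e, rfl⟩
  have he := gen_mul_self (B := B) e
  obtain ⟨a, ha⟩ := hl x
  obtain ⟨b, hb⟩ := hr y
  obtain ⟨c, hc⟩ := hl z
  rw [h1] at ha
  subst ha
  refine ⟨⟨a, (greenR_iff_of_idem (B.of_mul_self e)).2 ⟨?_, b, ?_⟩,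
    (greenL_iff_of_idem (B.of_mul_self e)).2 ⟨?_, c, ?_⟩⟩, rfl⟩ <;> apply WithOne.coe_injective
  · exact h1
  · rw [WithOne.coe_mul, hb, ← mul_assoc, h3, he]; rfl
  · exact h2
  · rw [WithOne.coe_mul, hc, mul_assoc, h4, he]; rfl

end MaximalSubgroup

section Label

variable (act : E → E → Option E) {G : Type*} [Monoid G] (γ : E → E → G)

/-- The product of the labels of the edges along the path which starts at `j` and is spelled by a
word. -/
def label : E → List E → G
  | _, [] => 1
  | j, a :: w => γ j a * (act j a).elim 1 fun k => label k w

variable {act γ}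

theorem label_cons {j a k : E} (h : act j a = some k) (w : List E) :
    label act γ j (a :: w) = γ j a * label act γ k w := by
  simp [label, h]

theorem label_append {j k : E} {u : List E} (h : u.foldlM act j = some k) (v : List E) :
    label act γ j (u ++ v) = label act γ j u * label act γ k v := by
  induction u generalizing j with
  | nil =>
    obtain rfl : j = k := by simpa using h
    simp [label]
  | cons a u ih =>
    rw [List.foldlM_cons] at h
    obtain ⟨i, hi, h⟩ := Option.bind_eq_some_iff.1 h
    rw [List.cons_append, label_cons hi, label_cons hi, ih h, mul_assoc]

theorem map_label {G' : Type*} [Monoid G'] (f : G →* G') (j : E) (w : List E) :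
    f (label act γ j w) = label act (fun j a => f (γ j a)) j w := by
  induction w generalizing j with
  | nil => simp [label]
  | cons a w ih =>
    rw [label, label, map_mul]
    cases act j a with
    | none => simp
    | some k => simp [ih]

theorem label_congr {γ' : E → E → G} {p : E → Prop}
    (hp : ∀ {j a k}, p j → act j a = some k → p k)
    (h : ∀ {j a k}, p j → act j a = some k → γ j a = γ' j a) {j k : E} (hj : p j) {w : List E}
    (hw : w.foldlM act j = some k) : label act γ j w = label act γ' j w := by
  induction w generalizing j with
  | nil => rfl
  | cons a w ih =>
    rw [List.foldlM_cons] at hw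
    obtain ⟨i, hi, hw⟩ := Option.bind_eq_some_iff.1 hw
    rw [label_cons hi, label_cons hi, h hj hi, ih (hp hj hi) hw]

end Label

theorem exists_act_of_foldlM {act : E → E → Option E} {f j : E} {w : List E} (hw : w ≠ [])
    (h : w.foldlM act f = some j) : ∃ f' a, act f' a = some j := by
  obtain ⟨u, a, rfl⟩ := List.eq_nil_or_concat' w |>.resolve_left hw
  rw [List.foldlM_append] at h
  obtain ⟨k, -, h⟩ := Option.bind_eq_some_iff.1 h
  exact ⟨k, a, by simpa using h⟩

/-- The state `j` is reachable from `j₀`. -/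
def Reachable (act : E → E → Option E) (j₀ j : E) : Prop := ∃ w : List E, w.foldlM act j₀ = some j

theorem Reachable.refl (act : E → E → Option E) (j₀ : E) : Reachable act j₀ j₀ := ⟨[], rfl⟩

theorem Reachable.foldlM {act : E → E → Option E} {j₀ j k : E} (h : Reachable act j₀ j)
    {w : List E} (hw : w.foldlM act j = some k) : Reachable act j₀ k := by
  obtain ⟨u, hu⟩ := h
  exact ⟨u ++ w, by rw [List.foldlM_append, hu]; exact hw⟩

theorem Reachable.step {act : E → E → Option E} {j₀ j k a : E} (h : Reachable act j₀ j)
    (hk : act j a = some k) : Reachable act j₀ k :=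
  h.foldlM (w := [a]) (by simpa using hk)

/-- The labels of edges satisfy the relations of the biordered set. -/
def IsLabelling (B : BiorderedSet E) (act : E → E → Option E) (j₀ : E) {G : Type*} [Monoid G]
    (γ : E → E → G) : Prop :=
  ∀ ⦃a b c j k l⦄, B.op a b = some c → Reachable act j₀ j → act j a = some k → act k b = some l →
    γ j a * γ k b = γ j c

/-- Having end `k` and having a prescribed label are carried together as one rewriting invariant,
since the relations on labels are only assumed along edges of the reachable graph. -/
theorem IsLabelling.label_eq {act : E → E → Option E} (hact : B.IsRightAction act) {j₀ : E}
    {G : Type*} [Monoid G] {γ : E → E → G} (hγ : B.IsLabelling act j₀ γ) {w w' : List E}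
    (hw : B.value w = B.value w') {j k : E} (hj : Reachable act j₀ j)
    (h : w.foldlM act j = some k) : label act γ j w = label act γ j w' := by
  refine ((iff_of_value_eq (P := fun w' => w'.foldlM act j = some k ∧
    label act γ j w = label act γ j w') ?_ hw).1 ⟨h, rfl⟩).2
  intro u v a b c hc
  rw [List.foldlM_append, List.foldlM_append]
  cases hu : u.foldlM act j with
  | none => simp
  | some i =>
    rw [label_append hu, label_append hu]
    have hb := hact.bind_eq hc i
    cases hi : act i a with
    | none =>
      rw [hi] at hb
      have hb : act i c = none := hb.symm
      simp [hi, hb]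
    | some k' =>
      rw [hi, Option.bind_some] at hb
      cases hl : act i c with
      | none => simp [hi, hl, hb]
      | some l =>
        rw [hl] at hb
        rw [label_cons hi, label_cons hb, label_cons hl, ← hγ hc (hj.foldlM hu) hi hb]
        simp [hi, hl, hb, mul_assoc]

section Presentation

variable {act : E → E → Option E} (hact : B.IsRightAction act) {e j₀ : E}
  (hj₀ : act e e = some j₀)
include hact hj₀

theorem exists_of_foldlM {w : List E} {j : E} (h : w.foldlM act j₀ = some j) :
    ∃ x t, B.gen e * B.value w * x = B.gen e ∧
      B.gen e * B.value w * B.gen j = B.gen e * B.value w ∧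
      t * B.gen e * B.value w = B.gen j := by
  obtain ⟨x, t, h1, h2, h3⟩ := B.isFaithful_gen.foldlM hact (f := e) (w := e :: w) (j := j) (by
    rw [List.foldlM_cons, hj₀]; exact h)
  have he := gen_mul_self (B := B) e
  rw [prod_gen, value_cons'] at h1 h2 h3
  exact ⟨x, t, by grind, by grind, by grind⟩

theorem act_self : act j₀ e = some j₀ := by
  have := hact.bind_eq (B.op_self e) e
  rwa [hj₀] at this

theorem foldlM_of_mul_eq {w : List E} {s : WithOne B.IG} (h : B.gen e * B.value w * s = B.gen e) :
    ∃ j, w.foldlM act j₀ = some j := by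
  have he := gen_mul_self (B := B) e
  obtain ⟨j, hj⟩ := B.isFaithful_gen.exists_foldlM hact (f := e) (w := e :: w) (s := s) (by
    rw [prod_gen, value_cons']; grind)
  rw [List.foldlM_cons, hj₀] at hj
  exact ⟨j, hj⟩

/-- Words representing elements of `H_e` spell loops at `j₀`: the path exists because `h R e`, and
it closes up because `h L e`. -/
theorem foldlM_of_val_eq {h : B.MaximalSubgroup e} {w : List E} (hw : B.value w = h.val) :
    w.foldlM act j₀ = some j₀ := by
  have h1 : h.val * h⁻¹.val = B.gen e := by
    rw [← MaximalSubgroup.val_mul, mul_inv_cancel, MaximalSubgroup.val_one]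
  have h2 : h⁻¹.val * h.val = B.gen e := by
    rw [← MaximalSubgroup.val_mul, inv_mul_cancel, MaximalSubgroup.val_one]
  have h3 := h.gen_mul_val
  have h4 := h.val_mul_gen
  obtain ⟨j, hj⟩ := foldlM_of_mul_eq hact hj₀ (w := w) (s := h⁻¹.val) (by
    rw [hw, h3, h1])
  obtain ⟨x, t, -, h6, h7⟩ := exists_of_foldlM hact hj₀ hj
  obtain ⟨x', t', -, h6', h7'⟩ := B.isFaithful_gen.act_eq hact hj₀
  -- Only values of `act` are known to be canonical; the extra first letter `e` makes the path
  -- nonempty, so its end is such a value.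
  obtain ⟨f, a, hfa⟩ := exists_act_of_foldlM (f := e) (w := e :: w) (j := j) (act := act)
    (by simp) (by rw [List.foldlM_cons, hj₀]; exact hj)
  have he := gen_mul_self (B := B) e
  rw [hw] at h6 h7
  rw [hj, hact.canonical hfa hj₀ (B.isFaithful_gen.lRel_iff.2 ⟨?_, ?_⟩)]
  · rw [← h7]; grind
  · rw [← h7', ← h2]; grind

variable {r : E → List E} (hr : ∀ j, Reachable act j₀ j → (r j).foldlM act j₀ = some j)
  (hr₀ : r j₀ = [])
include hr

/-- This is the injectivity in Green's lemma: right multiplication by `r k` is undone on `H_e` by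
some `x` with `e (r k) x = e`. -/
theorem eq_of_val_mul_eq {h h' : B.MaximalSubgroup e} {k : E} (hk : Reachable act j₀ k)
    (H : h.val * (B.gen e * B.value (r k)) = h'.val * (B.gen e * B.value (r k))) : h = h' := by
  obtain ⟨x, t, h1, -, -⟩ := exists_of_foldlM hact hj₀ (hr k hk)
  apply MaximalSubgroup.val_injective
  have := congrArg (· * x) H
  simp only [mul_assoc] at this h1
  rw [h1, h.val_mul_gen, h'.val_mul_gen] at this
  exact this

/-- The elements of the maximal subgroup which label the edges of the action. -/
theorem exists_labels : ∃ η : E → E → B.MaximalSubgroup e, ∀ {j a k}, Reachable act j₀ j →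
    act j a = some k →
    (η j a).val * (B.gen e * B.value (r k)) = B.gen e * B.value (r j) * B.gen a := by
  classical
  have key : ∀ j a, ∃ h : B.MaximalSubgroup e, ∀ k, Reachable act j₀ j → act j a = some k →
      h.val * (B.gen e * B.value (r k)) = B.gen e * B.value (r j) * B.gen a := by
    intro j a
    by_cases hj : ∃ k, Reachable act j₀ j ∧ act j a = some k
    · obtain ⟨k, hj, hk⟩ := hj
      have he := gen_mul_self (B := B) e
      obtain ⟨x, t, h1, h2, h3⟩ := exists_of_foldlM hact hj₀ (hr k (hj.step hk))
      have hja : (r j ++ [a]).foldlM act j₀ = some k := by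
        rw [List.foldlM_append, hr j hj]
        simpa using hk
      obtain ⟨x', t', h1', h2', h3'⟩ := exists_of_foldlM hact hj₀ hja
      rw [value_append, value_singleton] at h1' h2' h3'
      obtain ⟨p, hp⟩ : ∃ p, p = B.value (r k) := ⟨_, rfl⟩
      rw [← hp] at h1 h2 h3
      obtain ⟨y, hy⟩ : ∃ y, y = B.value (r j) * B.gen a := ⟨_, rfl⟩
      rw [← hy] at h1' h2' h3'
      have he' : ∀ z, B.gen e * (B.gen e * z) = B.gen e * z := fun z => by
        rw [← mul_assoc, he]
      have h4 : B.gen e * y * (x * B.gen e) * p = B.gen e * y := by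
        calc B.gen e * y * (x * B.gen e) * p
            = B.gen e * y * B.gen k * (x * B.gen e) * p := by rw [h2']
          _ = B.gen e * y * t * (B.gen e * p * x) * (B.gen e * p) := by
              rw [← h3]; simp only [mul_assoc]
          _ = B.gen e * y * (t * B.gen e * p) := by rw [h1]; simp only [mul_assoc, he']
          _ = B.gen e * y := by rw [h3, h2']
      -- The label is `e (r j) a x e`, where `e (r k) x = e` brings the end `k` back to the
      -- `H`-class of `e`.
      obtain ⟨h, hh⟩ := MaximalSubgroup.exists_val_eq (e := e)
        (x := B.gen e * y * (x * B.gen e)) (y := B.gen e * p * x') (z := B.gen e * p * t')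
        (by simp only [mul_assoc, he']) (by simp only [mul_assoc, he]) (by
          calc B.gen e * y * (x * B.gen e) * (B.gen e * p * x')
              = B.gen e * y * (x * B.gen e) * p * x' := by simp only [mul_assoc, he']
            _ = B.gen e := by rw [h4, h1']) (by
          calc B.gen e * p * t' * (B.gen e * y * (x * B.gen e))
              = B.gen e * p * (t' * B.gen e * y) * x * B.gen e := by simp only [mul_assoc]
            _ = B.gen e := by rw [h3', h2, h1, he])
      refine ⟨h, fun k' _ hk' => ?_⟩
      obtain rfl : k = k' := Option.some.inj (hk.symm.trans hk')
      rw [hh, mul_assoc (B.gen e) (B.value (r j)), ← hy, ← hp]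
      calc B.gen e * y * (x * B.gen e) * (B.gen e * p)
          = B.gen e * y * (x * B.gen e) * p := by simp only [mul_assoc, he']
        _ = B.gen e * y := h4
    · exact ⟨1, fun k h1 h2 => (hj ⟨k, h1, h2⟩).elim⟩
  choose η hη using key
  exact ⟨η, fun {j a k} => hη j a k⟩

variable {η : E → E → B.MaximalSubgroup e} (hη : ∀ {j a k}, Reachable act j₀ j →
    act j a = some k →
    (η j a).val * (B.gen e * B.value (r k)) = B.gen e * B.value (r j) * B.gen a)

include hη

omit hact hj₀ hr in
theorem val_label {w : List E} {j k : E} (hj : Reachable act j₀ j) (h : w.foldlM act j = some k) :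
    (label act η j w).val * (B.gen e * B.value (r k)) =
      B.gen e * B.value (r j) * B.value w := by
  induction w generalizing j with
  | nil =>
    obtain rfl : j = k := by simpa using h
    rw [label, MaximalSubgroup.val_one, value_nil, ← mul_assoc, gen_mul_self, mul_one]
  | cons a w ih =>
    rw [List.foldlM_cons] at h
    obtain ⟨i, hi, h⟩ := Option.bind_eq_some_iff.1 h
    rw [label_cons hi, MaximalSubgroup.val_mul, mul_assoc, ih (hj.step hi) h, ← mul_assoc,
      hη hj hi, value_cons', mul_assoc]

theorem isLabelling_labels : B.IsLabelling act j₀ η := by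
  intro a b c j k l hc hj hk hl
  have hjc : act j c = some l := by rw [← hact.bind_eq hc, hk]; exact hl
  refine eq_of_val_mul_eq hact hj₀ hr (hj.step hjc) ?_
  rw [hη hj hjc, MaximalSubgroup.val_mul, mul_assoc, hη (hj.step hk) hl, ← mul_assoc, hη hj hk,
    mul_assoc, B.isFaithful_gen.map_op hc]

include hr₀

theorem label_rep_eq_one {j : E} (hj : Reachable act j₀ j) : label act η j₀ (r j) = 1 := by
  refine eq_of_val_mul_eq hact hj₀ hr hj ?_
  rw [val_label hη (.refl _ _) (hr j hj), hr₀, value_nil, mul_one, MaximalSubgroup.val_one,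
    ← mul_assoc, gen_mul_self]

/-- A group generated by labels, which satisfy the relations of the biordered set and are trivial
along the chosen paths, is isomorphic to the maximal subgroup. -/
theorem bijective_of_labelling {G : Type*} [Group G] {γ : E → E → G}
    (hγ : B.IsLabelling act j₀ γ) (hγr : ∀ j, Reachable act j₀ j → label act γ j₀ (r j) = 1)
    (hgen : Subgroup.closure {x | ∃ j a k, Reachable act j₀ j ∧ act j a = some k ∧ γ j a = x} = ⊤)
    (ψ : G →* B.MaximalSubgroup e)
    (hψ : ∀ {j a k}, Reachable act j₀ j → act j a = some k → ψ (γ j a) = η j a) :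
    Function.Bijective ψ := by
  choose word hword using fun h : B.MaximalSubgroup e => exists_value_eq h.val
  have hlabel : ∀ (h : B.MaximalSubgroup e) w, B.value w = h.val →
      label act γ j₀ (word h) = label act γ j₀ w := fun h w hw =>
    hγ.label_eq hact ((hword h).trans hw.symm) (.refl _ _) (foldlM_of_val_eq hact hj₀ (hword h))
  -- The candidate inverse reads the label of any word for `h`; it is multiplicative because such
  -- words are loops at `j₀`.
  let θ : B.MaximalSubgroup e →* G := MonoidHom.mk' (fun h => label act γ j₀ (word h)) (by
    intro h h'
    rw [hlabel (h * h') (word h ++ word h') (by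
      rw [value_append, hword, hword, MaximalSubgroup.val_mul])]
    exact label_append (foldlM_of_val_eq hact hj₀ (hword h)) _)
  have hθ : ∀ (h : B.MaximalSubgroup e) w, B.value w = h.val → θ h = label act γ j₀ w := hlabel
  have hψθ : ∀ h, ψ (θ h) = h := by
    intro h
    have hw := foldlM_of_val_eq hact hj₀ (hword h)
    rw [hθ h _ (hword h), map_label,
      label_congr (p := Reachable act j₀) (fun h => h.step) (γ' := η) hψ (.refl _ _) hw]
    refine eq_of_val_mul_eq hact hj₀ hr (.refl _ _) ?_
    rw [val_label hη (.refl _ _) hw, hr₀, value_nil, mul_one, hword, h.gen_mul_val, h.val_mul_gen]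
  have hθψ : θ.comp ψ = MonoidHom.id G := by
    refine MonoidHom.eq_of_eqOn_dense hgen ?_
    rintro _ ⟨j, a, k, hj, hk, rfl⟩
    rw [MonoidHom.comp_apply, hψ hj hk, MonoidHom.id_apply]
    have hk' := hj.step hk
    obtain ⟨x, t, h1, -, -⟩ := exists_of_foldlM hact hj₀ (hr k hk')
    -- The word `s` leads from `k` back to `j₀`. Since `e (r k) s` represents `e` and `r k` has
    -- trivial label, `s` has trivial label too, so the loop `e (r j) a s` has label `γ j a` and
    -- value `η j a`.
    obtain ⟨s, hs⟩ := exists_value_eq (x * B.gen e)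
    have he := gen_mul_self (B := B) e
    have hje := act_self hact hj₀
    have hγe : γ j₀ e = 1 := mul_eq_left.1 (hγ (B.op_self e) (.refl _ _) hje hje)
    have h2 : label act γ k s = 1 := by
      have := hθ 1 (e :: (r k ++ s)) (by
        rw [value_cons', value_append, hs, MaximalSubgroup.val_one, ← mul_assoc (B.value (r k)),
          ← mul_assoc, ← mul_assoc, h1, he])
      rwa [label_cons hje, label_append (hr k hk'), hγr k hk', hγe, one_mul, one_mul, map_one,
        eq_comm] at this
    rw [hθ _ (e :: (r j ++ a :: s)) ?_, label_cons hje, label_append (hr j hj), hγr j hj,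
      label_cons hk, h2, hγe, one_mul, one_mul, mul_one]
    have := congrArg (· * (x * B.gen e)) (hη hj hk)
    calc B.value (e :: (r j ++ a :: s))
        = B.gen e * B.value (r j) * B.gen a * (x * B.gen e) := by
          rw [value_cons', value_append, value_cons', hs]; simp only [mul_assoc]
      _ = (η j a).val * (B.gen e * B.value (r k) * x) * B.gen e := by
          rw [← this]; simp only [mul_assoc]
      _ = (η j a).val := by rw [h1, MaximalSubgroup.val_mul_gen, MaximalSubgroup.val_mul_gen]
  refine ⟨fun x y hxy => ?_, fun h => ⟨θ h, hψθ h⟩⟩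
  have := congrArg θ hxy
  rwa [← MonoidHom.comp_apply, ← MonoidHom.comp_apply, hθψ] at this

end Presentation

end BiorderedSet

/-! ### General computability lemmas -/

theorem Primrec.foldlM_option {α β σ : Type*} [Primcodable α] [Primcodable β] [Primcodable σ]
    {f : α → List β} {g : α → σ} {h : α → σ → β → Option σ} (hf : Primrec f) (hg : Primrec g)
    (hh : Primrec fun p : α × σ × β => h p.1 p.2.1 p.2.2) :
    Primrec fun a => (f a).foldlM (h a) (g a) := by
  have : Primrec fun a => (f a).foldl (fun s b => s.bind fun x => h a x b) (some (g a)) := by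
    refine Primrec.list_foldl (h := fun a p => p.1.bind fun x => h a x p.2) hf
      (Primrec.option_some.comp hg) ?_
    refine Primrec.option_bind (Primrec.fst.comp Primrec.snd) ?_
    exact hh.comp (Primrec.pair (Primrec.fst.comp Primrec.fst)
      (Primrec.pair Primrec.snd (Primrec.snd.comp (Primrec.snd.comp Primrec.fst))))
  exact this.of_eq fun a => (List.foldlM_eq_foldl _ _ _).symm

/-- Finitely many algorithms merge into one with no uniformity assumption; this combines the word
problems of the groups `H_e`. -/
theorem Computable.of_forall_fin {n : ℕ} {α σ : Type*} [Primcodable α] [Primcodable σ]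
    {f : Fin n → α → σ} (hf : ∀ i, Computable (f i)) :
    Computable fun p : Fin n × α => f p.1 p.2 := by
  refine (Computable.vector_get.comp ((Computable.vector_ofFn hf).comp Computable.snd)
    Computable.fst).of_eq fun p => ?_
  simp

theorem Computable.option_bind_map {α β σ : Type*} [Primcodable α] [Primcodable β] [Primcodable σ]
    {f g : α → Option β} {h : α × β × β → σ} (hf : Computable f) (hg : Computable g)
    (hh : Computable h) :
    Computable fun a => (f a).bind fun s => (g a).map fun t => h (a, s, t) := by
  refine Computable.option_bind (g := fun a s => (g a).map fun t => h (a, s, t)) hf ?_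
  refine Computable.option_map (g := fun (p : α × β) t => h (p.1, p.2, t))
    (hg.comp Computable.fst) ?_
  exact hh.comp ((Computable.fst.comp Computable.fst).pair
    ((Computable.snd.comp Computable.fst).pair Computable.snd))

/-! ### Testing regularity and deciding equality of regular words -/

namespace BiorderedSet

section Rep

variable {E : Type u} {B : BiorderedSet E} {act ract : E → E → Option E}

theorem opp_act_eq (hract : B.opp.IsRightAction ract) {f a k : E} (h : ract f a = some k) :
    ∃ x t, x * (B.gen a * B.gen f) = B.gen f ∧
      B.gen k * (B.gen a * B.gen f) = B.gen a * B.gen f ∧ B.gen a * B.gen f * t = B.gen k := by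
  obtain ⟨x, t, h1, h2, h3⟩ := B.isFaithful_gen.opp.act_eq hract h
  refine ⟨x.unop, t.unop, ?_, ?_, ?_⟩
  · simpa [mul_assoc] using congrArg MulOpposite.unop h1
  · simpa [mul_assoc] using congrArg MulOpposite.unop h2
  · simpa [mul_assoc] using congrArg MulOpposite.unop h3

theorem opp_isSome_act (hract : B.opp.IsRightAction ract) {f a : E} {s : WithOne B.IG}
    (h : s * (B.gen a * B.gen f) = B.gen f) : ∃ k, ract f a = some k :=
  Option.isSome_iff_exists.1 (B.isFaithful_gen.opp.isSome_act hract (s := MulOpposite.op s) (by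
    simpa [mul_assoc] using congrArg MulOpposite.op h))

variable (act ract) in
/-- The canonical idempotent which is `R`-related to a word, provided that the word has a seed. -/
def seedRep : List E → Option E
  | [] => none
  -- Only `f v R f` is tested at the chosen letter `f`. The condition `u f L f` is tested by letting
  -- the letters of `u` act from the left.
  | a :: w => if (w.foldlM act a).isSome then ract a a else (seedRep w).bind fun e => ract e a

theorem seedRep_eq_some (hact : B.IsRightAction act) (hract : B.opp.IsRightAction ract)
    {w : List E} {e : E} (h : seedRep act ract w = some e) :
    B.gen e * B.value w = B.value w ∧ (∃ x, B.value w * x = B.gen e) ∧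
      ∃ f a, ract f a = some e := by
  induction w generalizing e with
  | nil => simp [seedRep] at h
  | cons a w ih =>
    rw [seedRep] at h
    rw [value_cons']
    have ha := gen_mul_self (B := B) a
    split_ifs at h with hw
    · obtain ⟨j, hj⟩ := Option.isSome_iff_exists.1 hw
      obtain ⟨y, -, h1, -, -⟩ := B.isFaithful_gen.foldlM hact hj
      rw [prod_gen] at h1
      obtain ⟨x, t, -, h3, h4⟩ := opp_act_eq hract h
      exact ⟨by grind, ⟨y * t, by grind⟩, _, _, h⟩
    · obtain ⟨f, hf, h⟩ := Option.bind_eq_some_iff.1 h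
      obtain ⟨h1, ⟨y, h2⟩, -⟩ := ih hf
      obtain ⟨x, t, -, h3, h4⟩ := opp_act_eq hract h
      refine ⟨?_, ⟨y * t, by grind⟩, _, _, h⟩
      rw [← h1]
      simp only [← mul_assoc] at h3 ⊢
      rw [h3]

theorem seedRep_isSome_of_hasSeed (hact : B.IsRightAction act) (hract : B.opp.IsRightAction ract)
    {w : List E} (h : B.HasSeed w) : (seedRep act ract w).isSome = true := by
  induction w with
  | nil => exact (not_hasSeed_nil h).elim
  | cons a w ih =>
    rw [seedRep]
    split_ifs with hw
    · obtain ⟨k, hk⟩ := opp_isSome_act hract (f := a) (a := a) (s := 1) (by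
        rw [one_mul, gen_mul_self])
      rw [hk]; rfl
    · obtain ⟨u, f, v, x, y, h1, h2, h3⟩ := h
      rcases u with _ | ⟨b, u⟩
      · simp only [List.nil_append, List.cons.injEq] at h1
        obtain ⟨rfl, rfl⟩ := h1
        obtain ⟨j, hj⟩ := B.isFaithful_gen.exists_foldlM hact h3
        simp [hj] at hw
      · simp only [List.cons_append, List.cons.injEq] at h1
        obtain ⟨rfl, rfl⟩ := h1
        rw [value_cons'] at h2
        obtain ⟨e, he⟩ := Option.isSome_iff_exists.1
          (ih ⟨u, f, v, x * B.gen a, y, rfl, by grind, h3⟩)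
        obtain ⟨h4, ⟨z, h5⟩, -⟩ := seedRep_eq_some hact hract he
        rw [value_append, value_cons'] at h5
        -- The representative `e` need not come from the seed `f`, but `e R u f v` and `x a u f = f`
        -- give `(u x) a e = e`, so `a` acts on `e`.
        obtain ⟨k, hk⟩ := opp_isSome_act hract (f := e) (a := a) (s := B.value u * x) (by
          rw [← h5]
          have := congrArg (B.value u * · * B.value v * z) h2
          simp only [mul_assoc] at this ⊢
          exact this)
        rw [he, Option.bind_some, hk]; rfl

theorem seedRep_isSome_iff (hact : B.IsRightAction act) (hract : B.opp.IsRightAction ract)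
    {w : List E} : (seedRep act ract w).isSome = true ↔ B.IsRegularWord w := by
  constructor
  · intro h
    obtain ⟨e, he⟩ := Option.isSome_iff_exists.1 h
    obtain ⟨h1, ⟨x, h2⟩, -⟩ := seedRep_eq_some hact hract he
    have hw : w ≠ [] := by
      rintro rfl
      simp [seedRep] at he
    obtain ⟨a, ha⟩ := WithOne.ne_one_iff_exists.1 (mt value_eq_one_iff.1 hw)
    refine ⟨a, ha.symm, ?_⟩
    have h3 : (a : WithOne B.IG) * x * a = a := by rw [ha, h2, h1]
    cases x with
    | one => exact ⟨a, WithOne.coe_injective (by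
        rw [mul_one] at h3
        rw [WithOne.coe_mul, WithOne.coe_mul, h3, h3])⟩
    | coe x => exact ⟨x, WithOne.coe_injective h3⟩
  · exact fun h => seedRep_isSome_of_hasSeed hact hract h.hasSeed

/-- Both outputs are values of `ract` in the `R`-class of the common element, and such values are
canonical. -/
theorem seedRep_eq_of_value_eq (hact : B.IsRightAction act) (hract : B.opp.IsRightAction ract)
    {u v : List E} {e e' : E} (hu : seedRep act ract u = some e)
    (hv : seedRep act ract v = some e') (h : B.value u = B.value v) : e = e' := by
  obtain ⟨h1, ⟨x, h2⟩, f, a, h3⟩ := seedRep_eq_some hact hract hu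
  obtain ⟨h4, ⟨y, h5⟩, f', a', h6⟩ := seedRep_eq_some hact hract hv
  refine hract.canonical h3 h6 (B.isFaithful_gen.opp.lRel_iff.2 ⟨?_, ?_⟩) <;>
    rw [← MulOpposite.op_mul, MulOpposite.op_inj]
  · rw [← h2, ← mul_assoc, h, h4]
  · rw [← h5, ← mul_assoc, ← h, h1]

end Rep

section Decide

variable {n : ℕ} {B : BiorderedSet (Fin n)}

theorem primrec_seedRep (act ract : Fin n → Fin n → Option (Fin n)) :
    Primrec (seedRep act ract) := by
  have h : Primrec fun w : List (Fin n) => List.recOn (motive := fun _ => Option (Fin n)) w none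
      fun a w IH => bif (w.foldlM act a).isSome then ract a a else IH.bind fun e => ract e a := by
    refine Primrec.list_rec (h := fun _ (p : Fin n × List (Fin n) × Option (Fin n)) =>
      bif (p.2.1.foldlM act p.1).isSome then ract p.1 p.1 else p.2.2.bind fun e => ract e p.1)
      Primrec.id (Primrec.const none) (Primrec.comp₂ ?_ Primrec₂.right)
    have hf : Primrec fun p : Fin n × List (Fin n) × Option (Fin n) => p.2.1.foldlM act p.1 :=
      Primrec.foldlM_option (h := fun _ => act) (Primrec.fst.comp Primrec.snd) Primrec.fst
        ((Primrec.dom_finite fun p : Fin n × Fin n => act p.1 p.2).comp Primrec.snd)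
    refine Primrec.cond (Primrec.option_isSome.comp hf)
      ((Primrec.dom_finite fun a => ract a a).comp Primrec.fst) ?_
    exact Primrec.option_bind (Primrec.snd.comp Primrec.snd)
      ((Primrec.dom_finite fun p : Fin n × Fin n => ract p.2 p.1).comp
        (Primrec.pair (Primrec.fst.comp Primrec.fst) Primrec.snd))
  refine h.of_eq fun w => ?_
  induction w with
  | nil => rfl
  | cons a w ih =>
    rw [seedRep, ← ih]
    cases h : (w.foldlM act a).isSome <;> simp [h]

/-- The end of a path, together with a word for its label. -/
def wordLabel {k : ℕ} (act : Fin n → Fin n → Option (Fin n))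
    (c : Fin n → Fin n → List (Fin k × Bool)) (j₀ : Fin n) (w : List (Fin n)) :
    Option (Fin n × List (Fin k × Bool)) :=
  w.foldlM (fun p a => (act p.1 a).map fun q => (q, p.2 ++ c p.1 a)) (j₀, [])

theorem primrec_wordLabel {k : ℕ} (act : Fin n → Fin n → Option (Fin n))
    (c : Fin n → Fin n → List (Fin k × Bool)) (j₀ : Fin n) : Primrec (wordLabel act c j₀) := by
  refine Primrec.foldlM_option (h := fun _ (p : Fin n × List (Fin k × Bool)) a =>
    (act p.1 a).map fun q => (q, p.2 ++ c p.1 a)) Primrec.id (Primrec.const _) ?_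
  have hp : Primrec fun p : List (Fin n) × (Fin n × List (Fin k × Bool)) × Fin n =>
      (p.2.1.1, p.2.2) :=
    Primrec.pair (Primrec.fst.comp (Primrec.fst.comp Primrec.snd)) (Primrec.snd.comp Primrec.snd)
  refine Primrec.option_map ((Primrec.dom_finite fun p : Fin n × Fin n => act p.1 p.2).comp hp) ?_
  refine Primrec.pair Primrec.snd (Primrec.list_append.comp ?_ ?_)
  · exact Primrec.snd.comp (Primrec.fst.comp (Primrec.snd.comp Primrec.fst))
  · exact (Primrec.dom_finite fun p : Fin n × Fin n => c p.1 p.2).comp (hp.comp Primrec.fst)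

theorem wordLabel_spec {k : ℕ} {act : Fin n → Fin n → Option (Fin n)}
    (c : Fin n → Fin n → List (Fin k × Bool)) {G : Type*} [Group G] (π : FreeGroup (Fin k) →* G)
    {w : List (Fin n)} {j₀ j : Fin n} (h : w.foldlM act j₀ = some j) :
    ∃ l, wordLabel act c j₀ w = some (j, l) ∧
      π (FreeGroup.mk l) = label act (fun j a => π (FreeGroup.mk (c j a))) j₀ w := by
  suffices H : ∀ i l₀, w.foldlM act i = some j → ∃ l,
      w.foldlM (fun (p : Fin n × List (Fin k × Bool)) a =>
        (act p.1 a).map fun q => (q, p.2 ++ c p.1 a)) (i, l₀) = some (j, l) ∧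
      π (FreeGroup.mk l) = π (FreeGroup.mk l₀) *
        label act (fun j a => π (FreeGroup.mk (c j a))) i w by
    obtain ⟨l, h1, h2⟩ := H j₀ [] h
    exact ⟨l, h1, by rw [h2, ← FreeGroup.one_eq_mk, map_one, one_mul]⟩
  clear h
  induction w with
  | nil =>
    intro i l₀ h
    obtain rfl : i = j := by simpa using h
    exact ⟨l₀, rfl, by simp [label]⟩
  | cons a w ih =>
    intro i l₀ h
    rw [List.foldlM_cons] at h
    obtain ⟨q, hq, h⟩ := Option.bind_eq_some_iff.1 h
    obtain ⟨l, h1, h2⟩ := ih q (l₀ ++ c i a) h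
    refine ⟨l, by rw [List.foldlM_cons, hq]; exact h1, ?_⟩
    rw [h2, label_cons hq, ← FreeGroup.mul_mk, map_mul, mul_assoc]

theorem primrec_invRev {α : Type*} [Primcodable α] :
    Primrec (FreeGroup.invRev : List (α × Bool) → List (α × Bool)) := by
  refine Primrec.list_reverse.comp (Primrec.list_map Primrec.id ?_)
  exact (Primrec.pair Primrec.fst (Primrec.not.comp Primrec.snd)).comp₂ Primrec₂.right

/-- The word problem within an `R`-class of a maximal subgroup with solvable word problem. -/
theorem exists_computable_of_hasSolvableWordProblem {act : Fin n → Fin n → Option (Fin n)}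
    (hact : B.IsRightAction act) (e : Fin n) (h : HasSolvableWordProblem (B.MaximalSubgroup e)) :
    ∃ D : List (Fin n) × List (Fin n) → Bool, Computable D ∧ ∀ u v x y,
      B.gen e * B.value u = B.value u → B.value u * x = B.gen e →
      B.gen e * B.value v = B.value v → B.value v * y = B.gen e →
      (D (u, v) = true ↔ B.value u = B.value v) := by
  classical
  obtain ⟨k, π, hπ, hdec, hcomp⟩ := h
  have hee : B.ActRel e e e := ⟨e, B.op_self e, B.op_self e, B.op_self e, B.op_self e⟩
  obtain ⟨j₀, hj₀⟩ := Option.isSome_iff_exists.1 (hact.isSome hee)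
  have hr : ∀ j, ∃ w : List (Fin n), (Reachable act j₀ j → w.foldlM act j₀ = some j) ∧
      (j = j₀ → w = []) := by
    intro j
    by_cases hj : j = j₀
    · exact ⟨[], fun _ => by rw [hj]; rfl, fun _ => rfl⟩
    by_cases hj' : Reachable act j₀ j
    · exact hj'.imp fun w hw => ⟨fun _ => hw, fun h => (hj h).elim⟩
    · exact ⟨[], fun h => (hj' h).elim, fun _ => rfl⟩
  choose r hr hr₀ using hr
  obtain ⟨η, hη⟩ := exists_labels hact hj₀ hr
  have hc : ∀ j a, ∃ l, π (FreeGroup.mk l) = η j a := by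
    intro j a
    obtain ⟨x, hx⟩ := hπ (η j a)
    exact ⟨x.toWord, by rw [FreeGroup.mk_toWord, hx]⟩
  choose c hc using hc
  have hc : (fun j a => π (FreeGroup.mk (c j a))) = η := funext₂ hc
  have hlab := isLabelling_labels hact hj₀ hr hη
  have hval : ∀ {w j}, w.foldlM act j₀ = some j → B.gen e * B.value w = B.value w →
      (label act η j₀ w).val * (B.gen e * B.value (r j)) = B.value w := by
    intro w j h1 h2
    rw [val_label hη (.refl _ _) h1, hr₀ j₀ rfl, value_nil, mul_one, h2]
  -- The action and the words `c j a` for the labels are finite data, so they may be chosen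
  -- nonconstructively and built into the algorithm.
  refine ⟨fun p => ((wordLabel act c j₀ p.1).bind fun s => (wordLabel act c j₀ p.2).map fun t =>
    decide (s.1 = t.1) && decide (π (FreeGroup.mk (s.2 ++ FreeGroup.invRev t.2)) = 1)).getD false,
    ?_, ?_⟩
  · have hw := (primrec_wordLabel act c j₀).to_comp
    have h1 : Computable fun p : (List (Fin n) × List (Fin n)) × (Fin n × List (Fin k × Bool)) ×
        (Fin n × List (Fin k × Bool)) => decide (p.2.1.1 = p.2.2.1) :=
      (Primrec.eq.decide.comp (Primrec.fst.comp (Primrec.fst.comp Primrec.snd))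
        (Primrec.fst.comp (Primrec.snd.comp Primrec.snd))).to_comp
    have h2 : Computable fun p : (List (Fin n) × List (Fin n)) × (Fin n × List (Fin k × Bool)) ×
        (Fin n × List (Fin k × Bool)) => p.2.1.2 ++ FreeGroup.invRev p.2.2.2 :=
      (Primrec.list_append.comp (Primrec.snd.comp (Primrec.fst.comp Primrec.snd))
        (primrec_invRev.comp (Primrec.snd.comp (Primrec.snd.comp Primrec.snd)))).to_comp
    exact Computable.option_getD (Computable.option_bind_map (hw.comp Computable.fst)
      (hw.comp Computable.snd) (Primrec.and.to_comp.comp h1 (hcomp.comp h2)))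
      (Computable.const false)
  · intro u v x y h1 h2 h3 h4
    obtain ⟨i, hi⟩ := foldlM_of_mul_eq hact hj₀ (w := u) (s := x) (by rw [h1, h2])
    obtain ⟨j, hj⟩ := foldlM_of_mul_eq hact hj₀ (w := v) (s := y) (by rw [h3, h4])
    obtain ⟨l, hl, hl'⟩ := wordLabel_spec c π hi
    obtain ⟨m, hm, hm'⟩ := wordLabel_spec c π hj
    rw [hc] at hl' hm'
    simp only [hl, hm, Option.bind_some, Option.map_some, Option.getD_some, Bool.and_eq_true,
      decide_eq_true_eq]
    rw [← FreeGroup.mul_mk, map_mul, ← FreeGroup.inv_mk, map_inv, mul_inv_eq_one, hl', hm']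
    constructor
    · rintro ⟨rfl, h⟩
      rw [← hval hi h1, ← hval hj h3, h]
    · intro h
      have hij := foldlM_eq_of_value_eq (B := B) (step := act) hact.bind_eq h j₀
      rw [hi, hj] at hij
      exact ⟨Option.some.inj hij, hlab.label_eq hact h (.refl _ _) hi⟩

/-- The word problem for words which represent regular elements. -/
theorem exists_computable_of_forall_hasSolvableWordProblem (B : BiorderedSet (Fin n))
    (h : ∀ e : Fin n, HasSolvableWordProblem (B.MaximalSubgroup e)) :
    ∃ D : List (Fin n) × List (Fin n) → Option Bool, Computable D ∧
      ∀ u v : List (Fin n),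
        ((D (u, v)).isSome = true ↔ B.IsRegularWord u ∧ B.IsRegularWord v) ∧
        (B.IsRegularWord u → B.IsRegularWord v →
          (D (u, v) = some true ↔ B.value u = B.value v)) := by
  obtain ⟨act, hact⟩ := B.exists_isRightAction
  obtain ⟨ract, hract⟩ := B.opp.exists_isRightAction
  choose D hD hD' using fun e => exists_computable_of_hasSolvableWordProblem hact e (h e)
  refine ⟨fun p => (seedRep act ract p.1).bind fun e => (seedRep act ract p.2).map fun e' =>
    decide (e = e') && D e p, ?_, fun u v => ⟨?_, ?_⟩⟩
  · have hs := (primrec_seedRep act ract).to_comp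
    have h1 : Computable fun p : (List (Fin n) × List (Fin n)) × Fin n × Fin n =>
        decide (p.2.1 = p.2.2) :=
      (Primrec.eq.decide.comp (Primrec.fst.comp Primrec.snd)
        (Primrec.snd.comp Primrec.snd)).to_comp
    have h2 : Computable fun p : (List (Fin n) × List (Fin n)) × Fin n × Fin n => (p.2.1, p.1) :=
      ((Primrec.fst.comp Primrec.snd).pair Primrec.fst).to_comp
    exact Computable.option_bind_map (hs.comp Computable.fst) (hs.comp Computable.snd)
      (Primrec.and.to_comp.comp h1 ((Computable.of_forall_fin hD).comp h2))
  · rw [← seedRep_isSome_iff hact hract, ← seedRep_isSome_iff hact hract]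
    cases hu : seedRep act ract u <;> cases hv : seedRep act ract v <;> simp [hu, hv]
  · rw [← seedRep_isSome_iff hact hract, ← seedRep_isSome_iff hact hract]
    intro hu hv
    obtain ⟨e, he⟩ := Option.isSome_iff_exists.1 hu
    obtain ⟨f, hf⟩ := Option.isSome_iff_exists.1 hv
    obtain ⟨h1, ⟨x, h2⟩, -⟩ := seedRep_eq_some hact hract he
    obtain ⟨h3, ⟨y, h4⟩, -⟩ := seedRep_eq_some hact hract hf
    simp only [he, hf, Option.bind_some, Option.map_some, Option.some.injEq, Bool.and_eq_true,
      decide_eq_true_eq]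
    constructor
    · rintro ⟨rfl, h⟩
      exact (hD' e u v x y h1 h2 h3 h4).1 h
    · intro h
      obtain rfl := seedRep_eq_of_value_eq hact hract he hf h
      exact ⟨rfl, (hD' e u v x y h1 h2 h3 h4).2 h⟩

end Decide

end BiorderedSet

/-! ### The finite presentation of a maximal subgroup -/

namespace BiorderedSet

section Relators

variable {n : ℕ} {B : BiorderedSet (Fin n)}

/-- The word for the edge labelled `a` at `j`. -/
def edgeWord (j a : Fin n) : List (Fin (n * n) × Bool) := [(finProdFinEquiv (j, a), true)]

/-- The relators of the presentation of a maximal subgroup. -/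
inductive IsRelator (B : BiorderedSet (Fin n)) (act : Fin n → Fin n → Option (Fin n)) (j₀ : Fin n)
    (r : Fin n → List (Fin n)) : List (Fin (n * n) × Bool) → Prop
  -- All `n * n` pairs serve as generators; those that are not edges of the reachable graph are
  -- killed.
  | edge (j a : Fin n) : (Reachable act j₀ j → act j a = none) →
      IsRelator B act j₀ r [(finProdFinEquiv (j, a), true)]
  | mul {a b c j k l : Fin n} : B.op a b = some c → Reachable act j₀ j → act j a = some k →
      act k b = some l → IsRelator B act j₀ r
        [(finProdFinEquiv (j, a), true), (finProdFinEquiv (k, b), true),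
          (finProdFinEquiv (j, c), false)]
  | path {j : Fin n} {L : List (Fin (n * n) × Bool)} : Reachable act j₀ j →
      wordLabel act edgeWord j₀ (r j) = some (j, L) → IsRelator B act j₀ r L

/-- The labels `η` satisfy the relators, which gives a homomorphism onto `H_e`. The generators form
a labelling of the presented group, so `bijective_of_labelling` makes it an isomorphism. -/
theorem nonempty_presentedGroup_mulEquiv {act : Fin n → Fin n → Option (Fin n)}
    (hact : B.IsRightAction act) {e j₀ : Fin n} (hj₀ : act e e = some j₀) {r : Fin n → List (Fin n)}
    (hr : ∀ j, Reachable act j₀ j → (r j).foldlM act j₀ = some j) (hr₀ : r j₀ = []) :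
    Nonempty (PresentedGroup {x | ∃ w, B.IsRelator act j₀ r w ∧ x = FreeGroup.mk w} ≃*
      B.MaximalSubgroup e) := by
  classical
  set rels := {x | ∃ w, B.IsRelator act j₀ r w ∧ x = FreeGroup.mk w} with hrels
  obtain ⟨η, hη⟩ := exists_labels hact hj₀ hr
  have hlab := isLabelling_labels hact hj₀ hr hη
  let f : Fin (n * n) → B.MaximalSubgroup e := fun i =>
    if Reachable act j₀ (finProdFinEquiv.symm i).1 ∧
      act (finProdFinEquiv.symm i).1 (finProdFinEquiv.symm i).2 ≠ none
    then η (finProdFinEquiv.symm i).1 (finProdFinEquiv.symm i).2 else 1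
  have hf : ∀ {j a k}, Reachable act j₀ j → act j a = some k →
      f (finProdFinEquiv (j, a)) = η j a := by
    intro j a k hj hk
    simp only [f, Equiv.symm_apply_apply]
    rw [if_pos ⟨hj, by simp [hk]⟩]
  have hmk : ∀ w, FreeGroup.lift f (FreeGroup.mk w) =
      (w.map fun x => cond x.2 (f x.1) (f x.1)⁻¹).prod := fun w => FreeGroup.lift_mk
  have hedge : ∀ j a, FreeGroup.lift f (FreeGroup.mk (edgeWord j a)) =
      f (finProdFinEquiv (j, a)) := fun j a => by rw [hmk]; simp [edgeWord]
  have hone : ∀ x ∈ rels, FreeGroup.lift f x = 1 := by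
    rintro _ ⟨w, hw, rfl⟩
    cases hw with
    | edge j a h =>
      rw [hmk]
      simp only [f, List.map_cons, List.map_nil, List.prod_cons, List.prod_nil, cond_true,
        mul_one, Equiv.symm_apply_apply]
      rw [if_neg fun h' => h'.2 (h h'.1)]
    | @mul a b c j k l hc hj hk hl =>
      have hjc : act j c = some l := by rw [← hact.bind_eq hc, hk]; exact hl
      rw [hmk]
      simp only [List.map_cons, List.map_nil, List.prod_cons, List.prod_nil, cond_true, cond_false]
      rw [hf hj hk, hf (hj.step hk) hl, hf hj hjc, mul_one, ← mul_assoc, hlab hc hj hk hl,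
        mul_inv_cancel]
    | @path j L hj hL =>
      obtain ⟨l, hl, hl'⟩ := wordLabel_spec edgeWord (FreeGroup.lift f) (hr j hj)
      obtain rfl : l = w := by simpa using hl.symm.trans hL
      rw [hl', label_congr (p := Reachable act j₀) (fun h => h.step) (γ' := η) ?_ (.refl _ _)
        (hr j hj), label_rep_eq_one hact hj₀ hr hr₀ hη hj]
      intro j a k hj hk
      rw [hedge, hf hj hk]
  have hrel : ∀ w, B.IsRelator act j₀ r w → PresentedGroup.mk rels (FreeGroup.mk w) = 1 :=
    fun w hw => PresentedGroup.one_of_mem ⟨w, hw, rfl⟩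
  let γ : Fin n → Fin n → PresentedGroup rels := fun j a =>
    PresentedGroup.mk rels (FreeGroup.mk (edgeWord j a))
  have hγ : B.IsLabelling act j₀ γ := by
    intro a b c j k l hc hj hk hl
    have := hrel _ (.mul hc hj hk hl)
    rw [show [(finProdFinEquiv (j, a), true), (finProdFinEquiv (k, b), true),
      (finProdFinEquiv (j, c), false)] = edgeWord j a ++ (edgeWord k b ++
        FreeGroup.invRev (edgeWord j c)) from rfl, ← FreeGroup.mul_mk, ← FreeGroup.mul_mk,
      ← FreeGroup.inv_mk, map_mul, map_mul, map_inv, ← mul_assoc, mul_inv_eq_one] at this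
    exact this
  refine ⟨MulEquiv.ofBijective (PresentedGroup.toGroup hone)
    (bijective_of_labelling hact hj₀ hr hr₀ hη hγ ?_ ?_ _ ?_)⟩
  · intro j hj
    obtain ⟨l, hl, hl'⟩ := wordLabel_spec edgeWord (PresentedGroup.mk rels) (hr j hj)
    rw [← hrel l (.path hj hl), hl']
  · rw [eq_top_iff, ← PresentedGroup.closure_range_of, Subgroup.closure_le]
    rintro _ ⟨i, rfl⟩
    obtain ⟨⟨j, a⟩, rfl⟩ := finProdFinEquiv.surjective i
    by_cases h : Reachable act j₀ j ∧ act j a ≠ none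
    · obtain ⟨k, hk⟩ := Option.ne_none_iff_exists'.1 h.2
      exact Subgroup.subset_closure ⟨j, a, k, h.1, hk, rfl⟩
    · rw [not_and, not_not] at h
      have : PresentedGroup.of (rels := rels) (finProdFinEquiv (j, a)) = 1 := hrel _ (.edge j a h)
      rw [this]
      exact one_mem _
  · intro j a k hj hk
    exact (hedge j a).trans (hf hj hk)

end Relators

end BiorderedSet

/-! ### Computing the presentation from the table -/

/-- The partial product of two elements in a partial multiplication table. -/
def tableOp (T : List (List (Option ℕ))) (a b : ℕ) : Option ℕ :=
  (T[a]?.bind fun l => l[b]?).bind id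

/-- The first element which is `L`-related to `g`. -/
def tableRep (n : ℕ) (T : List (List (Option ℕ))) (g : ℕ) : ℕ :=
  (List.range n).findIdx fun k =>
    decide (tableOp T g k = some g) && decide (tableOp T k g = some k)

/-- The first sandwich element which witnesses that `f a` is `R`-related to `f`. -/
def tableSandwich (n : ℕ) (T : List (List (Option ℕ))) (f a : ℕ) : ℕ :=
  -- If there is no sandwich element the index is `n`, which lies outside the table and makes
  -- `tableAct` undefined.
  (List.range n).findIdx fun h =>
    decide (tableOp T f h = some f) && (decide (tableOp T h f = some h) &&
      decide (tableOp T a h = some h))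

/-- The right action of the letters on the `L`-classes, computed from the table. -/
def tableAct (n : ℕ) (T : List (List (Option ℕ))) (f a : ℕ) : Option ℕ :=
  (tableOp T (tableSandwich n T f a) a).map (tableRep n T)

/-- The end and the label of the path which starts at `j₀` and is spelled by a word. -/
def tablePath (n : ℕ) (T : List (List (Option ℕ))) (j₀ : ℕ) (w : List ℕ) :
    Option (ℕ × List (ℕ × Bool)) :=
  w.foldlM (fun p a => (tableAct n T p.1 a).map fun k => (k, p.2 ++ [(a + n * p.1, true)]))
    (j₀, [])

/-- The entry of a list of optional words. -/
def pathEntry (r : List (Option (List ℕ))) (j : ℕ) : Option (List ℕ) := r[j]?.bind id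

/-- The end of an edge which starts at a reachable state. -/
def tableEdge (n : ℕ) (T : List (List (Option ℕ))) (r : List (Option (List ℕ))) (i : ℕ) :
    Option ℕ :=
  (pathEntry r (i / n)).bind fun _ => tableAct n T (i / n) (i % n)

/-- The relators of the presentation of a maximal subgroup, computed from the table and from a
list of paths to the reachable states. -/
def tableRelators (n : ℕ) (T : List (List (Option ℕ))) (j₀ : ℕ) (r : List (Option (List ℕ))) :
    List (List (ℕ × Bool)) :=
  ((List.range (n * n)).flatMap fun i =>
    ((tableEdge n T r i).map fun k => (List.range n).filterMap fun b =>
      (tableOp T (i % n) b).bind fun c => (tableAct n T k b).map fun _ =>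
        -- The pair `(j, a)` is coded by `a + n * j`, as in `finProdFinEquiv`. The default is the
        -- relator that kills a non-edge.
        [(i, true), (b + n * k, true), (c + n * (i / n), false)]).getD [[(i, true)]]) ++
  (List.range n).filterMap fun j => (pathEntry r j).bind fun w =>
    (tablePath n T j₀ w).map Prod.snd

/-- The presentation of the maximal subgroup of `e`. -/
def tablePresentation (n : ℕ) (T : List (List (Option ℕ))) (e : ℕ) (r : List (Option (List ℕ))) :
    FinPresentation :=
  (n * n, tableRelators n T ((tableAct n T e e).getD 0) r)

/-- Check that `r` is a list of paths to all states which are reachable from that of `e`. -/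
def checkPaths (n : ℕ) (T : List (List (Option ℕ))) (e : ℕ) (r : List (Option (List ℕ))) : Bool :=
  -- The recorded states contain the initial one, with the empty path; each recorded path ends at
  -- its own index; and the recorded states are closed under edges. Hence they are exactly the
  -- reachable ones.
  decide ((tableAct n T e e).bind (pathEntry r) = some []) &&
    ((List.range n).all (fun j => ((pathEntry r j).map fun w =>
      decide (((tableAct n T e e).bind fun j₀ => tablePath n T j₀ w).map Prod.fst =
        some j)).getD true) &&
    (List.range (n * n)).all fun i =>
      ((tableEdge n T r i).map fun k => (pathEntry r k).isSome).getD true)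

theorem List.findIdx_range_lt {n k : ℕ} {p : ℕ → Bool} (hk : k < n) (hp : p k = true) :
    (List.range n).findIdx p < n := by
  have := List.findIdx_lt_length_of_exists (p := p) (xs := List.range n)
    ⟨k, List.mem_range.2 hk, hp⟩
  rwa [List.length_range] at this

theorem List.findIdx_range_spec {n : ℕ} {p : ℕ → Bool} (h : (List.range n).findIdx p < n) :
    p ((List.range n).findIdx p) = true := by
  have := List.findIdx_getElem (p := p) (xs := List.range n) (w := by rwa [List.length_range])
  rwa [List.getElem_range] at this

theorem Fin.add_mul_div {n : ℕ} (a j : Fin n) : (a + n * j : ℕ) / n = j := by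
  rw [Nat.add_mul_div_left _ _ a.pos, Nat.div_eq_of_lt a.2, zero_add]

theorem Fin.add_mul_mod {n : ℕ} (a j : Fin n) : (a + n * j : ℕ) % n = a := by
  rw [Nat.add_mul_mod_self_left, Nat.mod_eq_of_lt a.2]

/-! ### Correctness of the table computations -/

namespace BiorderedSet

variable {n : ℕ} (B : BiorderedSet (Fin n))

theorem length_table : B.table.length = n := by simp [table]

theorem tableOp_table (a b : Fin n) : tableOp B.table a b = (B.op a b).map Fin.val := by
  simp [tableOp, table]

theorem tableOp_table_eq_none_left {a : ℕ} (ha : n ≤ a) (b : ℕ) : tableOp B.table a b = none := by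
  simp [tableOp, table, ha]

theorem tableOp_table_eq_none_right (a : ℕ) {b : ℕ} (hb : n ≤ b) :
    tableOp B.table a b = none := by
  rcases lt_or_ge a n with ha | ha
  · simp [tableOp, table, ha, hb]
  · exact B.tableOp_table_eq_none_left ha b

theorem tableOp_table_eq_some {a b c : Fin n} :
    tableOp B.table a b = some (c : ℕ) ↔ B.op a b = some c := by
  rw [tableOp_table]
  cases B.op a b <;> simp [Fin.ext_iff]

theorem tableAct_eq_none (f : ℕ) {a : ℕ} (ha : n ≤ a) : tableAct n B.table f a = none := by
  rw [tableAct, B.tableOp_table_eq_none_right _ ha]; rfl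

theorem exists_tableRep_eq (g : Fin n) : ∃ k : Fin n, tableRep n B.table g = k ∧ B.LRel g k := by
  have hlt : tableRep n B.table g < n :=
    List.findIdx_range_lt g.2 (by simp [tableOp_table_eq_some, B.op_self])
  have hs := List.findIdx_range_spec hlt
  rw [← tableRep] at hs
  generalize tableRep n B.table g = k at *
  lift k to Fin n using hlt
  exact ⟨k, rfl, by simpa [LRel, tableOp_table_eq_some] using hs⟩

theorem tableRep_eq_of_lRel {g g' : Fin n} (h : B.LRel g g') :
    tableRep n B.table g = tableRep n B.table g' := by
  rw [tableRep, tableRep]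
  congr 1
  ext k
  rcases lt_or_ge k n with hk | hk
  · lift k to Fin n using hk
    simp only [tableOp_table_eq_some, ← Bool.decide_and, decide_eq_decide]
    exact ⟨fun h' => B.lRel_equivalence.trans (B.lRel_equivalence.symm h) h',
      fun h' => B.lRel_equivalence.trans h h'⟩
  · simp [tableOp_table_eq_none_right _ _ hk]

theorem exists_isRightAction_tableAct : ∃ act, B.IsRightAction act ∧
    ∀ f a : Fin n, tableAct n B.table f a = (act f a).map Fin.val := by
  classical
  choose rep hrep hrep' using B.exists_tableRep_eq
  have key : ∀ f a : Fin n, (∃ g, B.ActRel f a g ∧ tableAct n B.table f a = some (rep g : ℕ)) ∨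
      (∀ g, ¬ B.ActRel f a g) ∧ tableAct n B.table f a = none := by
    intro f a
    rw [tableAct]
    rcases lt_or_ge (tableSandwich n B.table f a) n with hlt | hge
    · left
      have hs := List.findIdx_range_spec hlt
      rw [← tableSandwich] at hs
      generalize tableSandwich n B.table f a = h at *
      lift h to Fin n using hlt
      simp only [tableOp_table_eq_some, Bool.and_eq_true, decide_eq_true_eq] at hs
      obtain ⟨g, hg⟩ := exists_op_of_op_right hs.2.2
      exact ⟨g, ⟨h, hs.1, hs.2.1, hs.2.2, hg⟩, by rw [tableOp_table, hg, ← hrep]; rfl⟩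
    · right
      refine ⟨?_, by rw [B.tableOp_table_eq_none_left hge]; rfl⟩
      rintro g ⟨h, h1, h2, h3, -⟩
      refine hge.not_gt (List.findIdx_range_lt h.2 ?_)
      simp [tableOp_table_eq_some, h1, h2, h3]
  -- Including the computed value in the existential ensures that whichever `g` is chosen yields the
  -- output of `tableAct`.
  refine ⟨fun f a => if h : ∃ g, B.ActRel f a g ∧ tableAct n B.table f a = some (rep g : ℕ) then
    some (rep h.choose) else none, ⟨?_, ?_, ?_⟩, ?_⟩
  · intro f a k hk
    split_ifs at hk with h
    obtain rfl := Option.some.inj hk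
    exact ⟨_, h.choose_spec.1, hrep' _⟩
  · intro f a g hg
    rcases key f a with h | h
    · rw [dif_pos h]; rfl
    · exact (h.1 g hg).elim
  · intro f a k f' a' k' hk hk' hkk
    split_ifs at hk hk' with h h'
    obtain rfl := Option.some.inj hk
    obtain rfl := Option.some.inj hk'
    rw [Fin.ext_iff, ← hrep, ← hrep]
    exact B.tableRep_eq_of_lRel (B.lRel_equivalence.trans
      (B.lRel_equivalence.trans (hrep' _) hkk) (B.lRel_equivalence.symm (hrep' _)))
  · intro f a
    beta_reduce
    rcases key f a with h | h
    · rw [dif_pos h]; exact h.choose_spec.2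
    · rw [h.2, dif_neg fun h' => h.1 _ h'.choose_spec.1]; rfl

variable {B}

/-- Forget the bounds of the letters of a word. -/
def encodeWord {m : ℕ} (w : List (Fin m × Bool)) : List (ℕ × Bool) :=
  w.map fun a => ((a.1 : ℕ), a.2)

theorem encodeWord_injective {m : ℕ} : Function.Injective (encodeWord (m := m)) :=
  List.map_injective_iff.2 fun a b h => by
    simp only [Prod.mk.injEq] at h
    exact Prod.ext (Fin.ext h.1) h.2

/-- The search may propose arbitrary naturals as letters; one that is not below `n` makes the path
undefined. -/
theorem exists_eq_map_of_tablePath {w : List ℕ} {j₀ : ℕ} {p : ℕ × List (ℕ × Bool)}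
    (h : tablePath n B.table j₀ w = some p) : ∃ w' : List (Fin n), w = w'.map Fin.val := by
  rw [tablePath] at h
  generalize (j₀, ([] : List (ℕ × Bool))) = q at h
  induction w generalizing q with
  | nil => exact ⟨[], rfl⟩
  | cons a w ih =>
    rw [List.foldlM_cons] at h
    obtain ⟨x, hx, h⟩ := Option.bind_eq_some_iff.1 h
    obtain ⟨w', rfl⟩ := ih x h
    rcases lt_or_ge a n with ha | ha
    · exact ⟨⟨a, ha⟩ :: w', rfl⟩
    · simp [B.tableAct_eq_none _ ha] at hx

theorem wordLabel_map_fst (act : Fin n → Fin n → Option (Fin n))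
    (c : Fin n → Fin n → List (Fin (n * n) × Bool)) (j₀ : Fin n)
    (w : List (Fin n)) : (wordLabel act c j₀ w).map Prod.fst = w.foldlM act j₀ := by
  suffices H : ∀ (j : Fin n) (l : List (Fin (n * n) × Bool)),
      (w.foldlM (fun (p : Fin n × List (Fin (n * n) × Bool)) a =>
        (act p.1 a).map fun q => (q, p.2 ++ c p.1 a)) (j, l)).map Prod.fst =
      w.foldlM act j from H j₀ []
  induction w with
  | nil => exact fun j l => rfl
  | cons a w ih =>
    intro j l
    rw [List.foldlM_cons, List.foldlM_cons]
    cases act j a with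
    | none => rfl
    | some k => exact ih k _

section Correct

variable {act : Fin n → Fin n → Option (Fin n)}
  (htab : ∀ f a : Fin n, tableAct n B.table f a = (act f a).map Fin.val)
include htab

theorem tablePath_map (j₀ : Fin n) (w : List (Fin n)) :
    tablePath n B.table j₀ (w.map Fin.val) =
      (wordLabel act edgeWord j₀ w).map fun p => ((p.1 : ℕ), encodeWord p.2) := by
  suffices H : ∀ (j : Fin n) (l : List (Fin (n * n) × Bool)),
      (w.map Fin.val).foldlM (fun (p : ℕ × List (ℕ × Bool)) a =>
        (tableAct n B.table p.1 a).map fun k => (k, p.2 ++ [(a + n * p.1, true)]))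
        ((j : ℕ), encodeWord l) =
      (w.foldlM (fun (p : Fin n × List (Fin (n * n) × Bool)) a =>
        (act p.1 a).map fun q => (q, p.2 ++ edgeWord p.1 a)) (j, l)).map
        fun p => ((p.1 : ℕ), encodeWord p.2) from H j₀ []
  induction w with
  | nil => exact fun j l => rfl
  | cons a w ih =>
    intro j l
    rw [List.map_cons, List.foldlM_cons, List.foldlM_cons, htab]
    cases act j a with
    | none => rfl
    | some k =>
      have := ih k (l ++ edgeWord j a)
      simp only [encodeWord, edgeWord, List.map_append, List.map_cons, List.map_nil,
        finProdFinEquiv_apply_val] at this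
      exact this

theorem tablePath_map_fst (j₀ : Fin n) (w : List (Fin n)) :
    (tablePath n B.table j₀ (w.map Fin.val)).map Prod.fst = (w.foldlM act j₀).map Fin.val := by
  rw [tablePath_map htab, ← wordLabel_map_fst act edgeWord, Option.map_map, Option.map_map]
  rfl

/-- The entries of `r` are paths to the reachable states. -/
def IsPathTable (act : Fin n → Fin n → Option (Fin n)) (j₀ : Fin n)
    (r : List (Option (List ℕ))) (R : Fin n → List (Fin n)) : Prop :=
  R j₀ = [] ∧ ∀ j : Fin n, (Reachable act j₀ j → pathEntry r j = some ((R j).map Fin.val) ∧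
    (R j).foldlM act j₀ = some j) ∧ (¬ Reachable act j₀ j → pathEntry r j = none)

/-- This guarantees that the search for paths terminates. -/
theorem exists_checkPaths {e j₀ : Fin n} (hj₀ : act e e = some j₀) :
    ∃ r, checkPaths n B.table e r = true := by
  classical
  let R : Fin n → Option (List ℕ) := fun j =>
    if j = j₀ then some []
    else if h : Reachable act j₀ j then some (h.choose.map Fin.val) else none
  have hR : ∀ j : Fin n, pathEntry (List.ofFn R) j = R j := by
    intro j
    simp [pathEntry]
  have hR' : ∀ j : Fin n, Reachable act j₀ j → (R j).isSome = true := by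
    intro j hj
    simp only [R]
    split_ifs <;> rfl
  have hR'' : ∀ j : Fin n, ∀ w, R j = some w → Reachable act j₀ j ∧
      ∃ w' : List (Fin n), w = w'.map Fin.val ∧ w'.foldlM act j₀ = some j := by
    intro j w hw
    simp only [R] at hw
    split_ifs at hw with h1 h2
    · exact ⟨h1 ▸ .refl _ _, [], by simpa using hw.symm, by rw [h1]; rfl⟩
    · exact ⟨h2, _, (Option.some.inj hw).symm, h2.choose_spec⟩
  have hj₀' : tableAct n B.table e e = some (j₀ : ℕ) := by rw [htab, hj₀]; rfl
  refine ⟨List.ofFn R, ?_⟩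
  simp only [checkPaths, hj₀', Option.bind_some, Bool.and_eq_true, decide_eq_true_eq,
    List.all_eq_true, List.mem_range]
  refine ⟨by rw [hR]; simp [R], fun j hj => ?_, fun i hi => ?_⟩
  · lift j to Fin n using hj
    rw [hR]
    cases h : R j with
    | none => rfl
    | some w =>
      obtain ⟨-, w', rfl, h'⟩ := hR'' j w h
      rw [Option.map_some, Option.getD_some, tablePath_map_fst htab, h']
      simp
  · obtain ⟨⟨j, a⟩, hi⟩ := finProdFinEquiv.surjective (⟨i, hi⟩ : Fin (n * n))
    obtain rfl : (a + n * j : ℕ) = i := by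
      have := congrArg Fin.val hi
      rwa [finProdFinEquiv_apply_val] at this
    rw [tableEdge, Fin.add_mul_div, Fin.add_mul_mod, hR, htab]
    cases h : R j with
    | none => rfl
    | some w =>
      cases hk : act j a with
      | none => rfl
      | some k =>
        simp only [Option.map_some, Option.bind_some, Option.getD_some]
        rw [hR]
        exact hR' k ((hR'' j w h).1.step hk)

theorem tableEdge_eq {j₀ : Fin n} {r : List (Option (List ℕ))} {R : Fin n → List (Fin n)}
    (hR : IsPathTable act j₀ r R) (j a : Fin n) [Decidable (Reachable act j₀ j)] :
    tableEdge n B.table r (finProdFinEquiv (j, a)) =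
      if Reachable act j₀ j then (act j a).map Fin.val else none := by
  rw [finProdFinEquiv_apply_val]
  rw [tableEdge, Fin.add_mul_div, Fin.add_mul_mod, htab]
  split_ifs with h
  · rw [((hR.2 j).1 h).1]; rfl
  · rw [(hR.2 j).2 h]; rfl

theorem mem_tableRelators_iff {j₀ : Fin n} {r : List (Option (List ℕ))} {R : Fin n → List (Fin n)}
    (hR : IsPathTable act j₀ r R) (w : List (ℕ × Bool)) :
    w ∈ tableRelators n B.table j₀ r ↔ ∃ w', B.IsRelator act j₀ R w' ∧ encodeWord w' = w := by
  classical
  rw [tableRelators, List.mem_append, List.mem_flatMap, List.mem_filterMap]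
  constructor
  · rintro (⟨i, hi, hw⟩ | ⟨j, hj, hw⟩)
    · obtain ⟨⟨j, a⟩, hi'⟩ := finProdFinEquiv.surjective (⟨i, List.mem_range.1 hi⟩ : Fin (n * n))
      obtain rfl : (finProdFinEquiv (j, a) : ℕ) = i := congrArg Fin.val hi'
      rw [tableEdge_eq htab hR] at hw
      split_ifs at hw with hj
      · cases hk : act j a with
        | none =>
          simp only [hk, Option.map_none, Option.getD_none, List.mem_singleton] at hw
          exact ⟨_, .edge j a fun _ => hk, hw.symm⟩
        | some k =>
          simp only [hk, Option.map_some, Option.getD_some, List.mem_filterMap, List.mem_range]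
            at hw
          obtain ⟨b, hb, hw⟩ := hw
          lift b to Fin n using hb
          rw [finProdFinEquiv_apply_val, Fin.add_mul_div, Fin.add_mul_mod, tableOp_table, htab] at hw
          cases hc : B.op a b with
          | none => simp [hc] at hw
          | some c =>
            cases hl : act k b with
            | none => simp [hc, hl] at hw
            | some l =>
              refine ⟨_, .mul hc hj hk hl, ?_⟩
              simpa [hc, hl, encodeWord] using hw
      · simp only [Option.map_none, Option.getD_none, List.mem_singleton] at hw
        exact ⟨_, .edge j a fun h => (hj h).elim, hw.symm⟩
    · rw [List.mem_range] at hj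
      lift j to Fin n using hj
      by_cases h : Reachable act j₀ j
      · rw [((hR.2 j).1 h).1, Option.bind_some, tablePath_map htab, Option.map_map,
          Option.map_eq_some_iff] at hw
        obtain ⟨⟨k, L⟩, hL, rfl⟩ := hw
        have := wordLabel_map_fst act edgeWord j₀ (R j)
        rw [hL, ((hR.2 j).1 h).2] at this
        obtain rfl : k = j := Option.some.inj this
        exact ⟨L, .path h hL, rfl⟩
      · simp [(hR.2 j).2 h] at hw
  · rintro ⟨w', hw', rfl⟩
    have hmem : ∀ p : Fin n × Fin n, (finProdFinEquiv p : ℕ) ∈ List.range (n * n) := fun p =>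
      List.mem_range.2 (finProdFinEquiv p).2
    cases hw' with
    | edge j a h =>
      refine Or.inl ⟨_, hmem (j, a), ?_⟩
      rw [tableEdge_eq htab hR]
      split_ifs with hj
      · simp [h hj, encodeWord]
      · simp [encodeWord]
    | @mul a b c j k l hc hj hk hl =>
      refine Or.inl ⟨_, hmem (j, a), ?_⟩
      rw [tableEdge_eq htab hR, if_pos hj, hk, Option.map_some, Option.map_some,
        Option.getD_some, List.mem_filterMap]
      refine ⟨b, List.mem_range.2 b.2, ?_⟩
      rw [finProdFinEquiv_apply_val, Fin.add_mul_div, Fin.add_mul_mod, tableOp_table, htab, hc, hl]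
      simp [encodeWord]
    | @path j L hj hL =>
      refine Or.inr ⟨j, List.mem_range.2 j.2, ?_⟩
      rw [((hR.2 j).1 hj).1, Option.bind_some, tablePath_map htab, hL]
      rfl

/-- Soundness of the check: closure under edges, by induction along paths, gives every reachable
state an entry, while the recorded path shows that every state with an entry is reachable. -/
theorem exists_isPathTable {e j₀ : Fin n} (hj₀ : act e e = some j₀) {r : List (Option (List ℕ))}
    (h : checkPaths n B.table e r = true) : ∃ R, IsPathTable act j₀ r R := by
  classical
  have hj₀' : tableAct n B.table e e = some (j₀ : ℕ) := by rw [htab, hj₀]; rfl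
  simp only [checkPaths, hj₀', Option.bind_some, Bool.and_eq_true, decide_eq_true_eq,
    List.all_eq_true, List.mem_range] at h
  obtain ⟨h0, h1, h2⟩ := h
  have hstep : ∀ j a k : Fin n, (pathEntry r j).isSome = true → act j a = some k →
      (pathEntry r k).isSome = true := by
    intro j a k hj hk
    have := h2 _ (finProdFinEquiv (j, a)).2
    rw [finProdFinEquiv_apply_val] at this
    obtain ⟨w, hw⟩ := Option.isSome_iff_exists.1 hj
    rw [tableEdge, Fin.add_mul_div, Fin.add_mul_mod, hw, htab, hk] at this
    simpa using this
  have hreach : ∀ (w : List (Fin n)) (j k : Fin n), (pathEntry r j).isSome = true →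
      w.foldlM act j = some k → (pathEntry r k).isSome = true := by
    intro w
    induction w with
    | nil =>
      intro j k hj h
      obtain rfl : j = k := by simpa using h
      exact hj
    | cons a w ih =>
      intro j k hj h
      rw [List.foldlM_cons] at h
      obtain ⟨i, hi, h⟩ := Option.bind_eq_some_iff.1 h
      exact ih i k (hstep j a i hj hi) h
  have hpath : ∀ j : Fin n, ∀ w, pathEntry r j = some w →
      ∃ w' : List (Fin n), w = w'.map Fin.val ∧ w'.foldlM act j₀ = some j := by
    intro j w hw
    have := h1 j j.2
    rw [hw, Option.map_some, Option.getD_some, decide_eq_true_eq] at this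
    obtain ⟨p, hp, -⟩ := Option.map_eq_some_iff.1 this
    obtain ⟨w', rfl⟩ := exists_eq_map_of_tablePath hp
    rw [tablePath_map_fst htab] at this
    refine ⟨w', rfl, ?_⟩
    cases hw' : w'.foldlM act j₀ with
    | none => simp [hw'] at this
    | some k =>
      rw [hw', Option.map_some, Option.some_inj, ← Fin.ext_iff] at this
      rw [this]
  have hex : ∀ j : Fin n, ∃ w : List (Fin n),
      (Reachable act j₀ j → pathEntry r j = some (w.map Fin.val) ∧ w.foldlM act j₀ = some j) ∧
      (¬ Reachable act j₀ j → pathEntry r j = none) := by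
    intro j
    cases hj : pathEntry r j with
    | some w =>
      obtain ⟨w', rfl, hw'⟩ := hpath j w hj
      exact ⟨w', fun _ => ⟨rfl, hw'⟩, fun h => (h ⟨w', hw'⟩).elim⟩
    | none =>
      refine ⟨[], fun h => ?_, fun _ => rfl⟩
      obtain ⟨w, hw⟩ := h
      have := hreach w j₀ j (by rw [h0]; rfl) hw
      simp [hj] at this
  choose R hR using hex
  refine ⟨R, ?_, hR⟩
  have := ((hR j₀).1 (.refl _ _)).1
  rw [h0] at this
  simpa using this.symm

end Correct

variable (B) in
theorem presents_tablePresentation (e : Fin n) {r : List (Option (List ℕ))}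
    (h : checkPaths n B.table e r = true) :
    (tablePresentation n B.table e r).Presents (B.MaximalSubgroup e) := by
  obtain ⟨act, hact, htab⟩ := B.exists_isRightAction_tableAct
  obtain ⟨j₀, hj₀⟩ := Option.isSome_iff_exists.1
    (hact.isSome (f := e) (a := e) (g := e)
      ⟨e, B.op_self e, B.op_self e, B.op_self e, B.op_self e⟩)
  obtain ⟨R, hR⟩ := exists_isPathTable htab hj₀ h
  have hmem := mem_tableRelators_iff htab hR
  have hP : tablePresentation n B.table e r = (n * n, tableRelators n B.table j₀ r) := by
    rw [tablePresentation, htab, hj₀]; rfl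
  rw [hP]
  refine ⟨?_, ?_⟩
  · intro w hw a ha
    obtain ⟨w', -, rfl⟩ := (hmem w).1 hw
    obtain ⟨b, -, rfl⟩ := List.mem_map.1 ha
    exact b.1.2
  · have : FinPresentation.relators (n * n, tableRelators n B.table j₀ r) =
        {x | ∃ w, B.IsRelator act j₀ R w ∧ x = FreeGroup.mk w} := by
      ext x
      refine exists_congr fun w => and_congr_left fun _ => ?_
      refine (hmem (encodeWord w)).trans ⟨?_, fun h => ⟨w, h, rfl⟩⟩
      rintro ⟨w', hw', hww⟩
      rwa [← encodeWord_injective hww]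
    rw [this]
    exact nonempty_presentedGroup_mulEquiv hact hj₀ (fun j hj => ((hR.2 j).1 hj).2) hR.1

variable (B) in
theorem exists_checkPaths_table (e : Fin n) : ∃ r, checkPaths n B.table e r = true := by
  obtain ⟨act, hact, htab⟩ := B.exists_isRightAction_tableAct
  obtain ⟨j₀, hj₀⟩ := Option.isSome_iff_exists.1
    (hact.isSome (f := e) (a := e) (g := e)
      ⟨e, B.op_self e, B.op_self e, B.op_self e, B.op_self e⟩)
  exact exists_checkPaths htab hj₀

end BiorderedSet

/-! ### Primitive recursiveness of the table computations -/

namespace Primrec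

variable {α β : Type*} [Primcodable α] [Primcodable β]

theorem list_all {f : α → List β} {p : α → β → Bool} (hf : Primrec f) (hp : Primrec₂ p) :
    Primrec fun a => (f a).all (p a) := by
  have : Primrec fun a => (f a).foldl (fun s b => s && p a b) true :=
    Primrec.list_foldl (h := fun a q => q.1 && p a q.2) hf (Primrec.const true)
      (Primrec.and.comp (Primrec.fst.comp Primrec.snd)
        (hp.comp Primrec.fst (Primrec.snd.comp Primrec.snd)))
  refine this.of_eq fun a => ?_
  suffices H : ∀ (l : List β) (s : Bool), l.foldl (fun s b => s && p a b) s = (s && l.all (p a)) by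
    rw [H, Bool.true_and]
  intro l
  induction l with
  | nil => simp
  | cons b l ih => intro s; rw [List.foldl_cons, ih, List.all_cons, Bool.and_assoc]

theorem eq_decide [DecidableEq β] {f g : α → β} (hf : Primrec f) (hg : Primrec g) :
    Primrec fun a => decide (f a = g a) :=
  Primrec.eq.decide.comp hf hg

variable {n j a b : α → ℕ} {T : α → List (List (Option ℕ))} {r : α → List (Option (List ℕ))}

theorem tableOp (hT : Primrec T) (ha : Primrec a) (hb : Primrec b) :
    Primrec fun x => tableOp (T x) (a x) (b x) :=
  Primrec.option_bind (g := fun _ o => id o)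
    (Primrec.option_bind (g := fun x l => l[b x]?) (Primrec.list_getElem?.comp hT ha)
      (Primrec.list_getElem?.comp Primrec.snd (hb.comp Primrec.fst))) Primrec₂.right

theorem tableRep (hn : Primrec n) (hT : Primrec T) (ha : Primrec a) :
    Primrec fun x => tableRep (n x) (T x) (a x) := by
  have hT' : Primrec fun p : α × ℕ => T p.1 := hT.comp Primrec.fst
  have ha' : Primrec fun p : α × ℕ => a p.1 := ha.comp Primrec.fst
  have hk : Primrec fun p : α × ℕ => p.2 := Primrec.snd
  exact Primrec.list_findIdx (Primrec.list_range.comp hn) (Primrec.and.comp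
    (eq_decide (tableOp hT' ha' hk) (Primrec.option_some.comp ha'))
    (eq_decide (tableOp hT' hk ha') (Primrec.option_some.comp hk)))

theorem tableSandwich (hn : Primrec n) (hT : Primrec T) (ha : Primrec a) (hb : Primrec b) :
    Primrec fun x => tableSandwich (n x) (T x) (a x) (b x) := by
  have hT' : Primrec fun p : α × ℕ => T p.1 := hT.comp Primrec.fst
  have ha' : Primrec fun p : α × ℕ => a p.1 := ha.comp Primrec.fst
  have hb' : Primrec fun p : α × ℕ => b p.1 := hb.comp Primrec.fst
  have hk : Primrec fun p : α × ℕ => p.2 := Primrec.snd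
  exact Primrec.list_findIdx (Primrec.list_range.comp hn) (Primrec.and.comp
    (eq_decide (tableOp hT' ha' hk) (Primrec.option_some.comp ha')) (Primrec.and.comp
      (eq_decide (tableOp hT' hk ha') (Primrec.option_some.comp hk))
      (eq_decide (tableOp hT' hb' hk) (Primrec.option_some.comp hk))))

theorem tableAct (hn : Primrec n) (hT : Primrec T) (ha : Primrec a) (hb : Primrec b) :
    Primrec fun x => tableAct (n x) (T x) (a x) (b x) :=
  Primrec.option_map (g := fun x g => _root_.tableRep (n x) (T x) g)
    (tableOp hT (tableSandwich hn hT ha hb) hb)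
    (tableRep (hn.comp Primrec.fst) (hT.comp Primrec.fst) Primrec.snd)

theorem tablePath {w : α → List ℕ} (hn : Primrec n) (hT : Primrec T) (hj : Primrec j)
    (hw : Primrec w) : Primrec fun x => tablePath (n x) (T x) (j x) (w x) := by
  refine Primrec.foldlM_option (h := fun x (p : ℕ × List (ℕ × Bool)) a =>
    (_root_.tableAct (n x) (T x) p.1 a).map fun k => (k, p.2 ++ [(a + n x * p.1, true)]))
    hw (Primrec.pair hj (Primrec.const [])) ?_
  have hn' : Primrec fun p : α × (ℕ × List (ℕ × Bool)) × ℕ => n p.1 := hn.comp Primrec.fst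
  have hi : Primrec fun p : α × (ℕ × List (ℕ × Bool)) × ℕ => p.2.1.1 :=
    Primrec.fst.comp (Primrec.fst.comp Primrec.snd)
  have hl : Primrec fun p : α × (ℕ × List (ℕ × Bool)) × ℕ => p.2.1.2 :=
    Primrec.snd.comp (Primrec.fst.comp Primrec.snd)
  have ha : Primrec fun p : α × (ℕ × List (ℕ × Bool)) × ℕ => p.2.2 :=
    Primrec.snd.comp Primrec.snd
  refine Primrec.option_map (tableAct hn' (hT.comp Primrec.fst) hi ha) ?_
  have he : Primrec fun p : α × (ℕ × List (ℕ × Bool)) × ℕ =>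
      p.2.1.2 ++ [(p.2.2 + n p.1 * p.2.1.1, true)] :=
    Primrec.list_concat.comp hl (Primrec.pair
      (Primrec.nat_add.comp ha (Primrec.nat_mul.comp hn' hi)) (Primrec.const true))
  exact Primrec.pair Primrec.snd (he.comp Primrec.fst)

theorem pathEntry (hr : Primrec r) (hj : Primrec j) :
    Primrec fun x => pathEntry (r x) (j x) :=
  Primrec.option_bind (g := fun _ o => id o) (Primrec.list_getElem?.comp hr hj) Primrec₂.right

theorem tableEdge (hn : Primrec n) (hT : Primrec T) (hr : Primrec r) (hj : Primrec j) :
    Primrec fun x => tableEdge (n x) (T x) (r x) (j x) := by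
  have hd : Primrec fun x => j x / n x := Primrec.nat_div.comp hj hn
  have hm : Primrec fun x => j x % n x := Primrec.nat_mod.comp hj hn
  exact Primrec.option_bind (g := fun x _ => _root_.tableAct (n x) (T x) (j x / n x) (j x % n x))
    (pathEntry hr hd) ((tableAct hn hT hd hm).comp Primrec.fst)

theorem tableRelators (hn : Primrec n) (hT : Primrec T) (hj : Primrec j) (hr : Primrec r) :
    Primrec fun x => tableRelators (n x) (T x) (j x) (r x) := by
  refine Primrec.list_append.comp ?_ ?_
  · refine Primrec.list_flatMap (g := fun x i => ((_root_.tableEdge (n x) (T x) (r x) i).map fun k =>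
      (List.range (n x)).filterMap fun b => (_root_.tableOp (T x) (i % n x) b).bind fun c =>
        (_root_.tableAct (n x) (T x) k b).map fun _ =>
          [(i, true), (b + n x * k, true), (c + n x * (i / n x), false)]).getD [[(i, true)]])
      (Primrec.list_range.comp (Primrec.nat_mul.comp hn hn)) ?_
    have hi : Primrec fun p : α × ℕ => p.2 := Primrec.snd
    refine Primrec.option_getD.comp (Primrec.option_map (tableEdge (hn.comp Primrec.fst)
      (hT.comp Primrec.fst) (hr.comp Primrec.fst) hi) ?_)
      (Primrec.list_cons.comp (Primrec.list_cons.comp (Primrec.pair hi (Primrec.const true))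
        (Primrec.const [])) (Primrec.const []))
    have hn₁ : Primrec fun p : (α × ℕ) × ℕ => n p.1.1 := hn.comp (Primrec.fst.comp Primrec.fst)
    refine Primrec.listFilterMap (g := fun (p : (α × ℕ) × ℕ) b =>
      (_root_.tableOp (T p.1.1) (p.1.2 % n p.1.1) b).bind fun c =>
        (_root_.tableAct (n p.1.1) (T p.1.1) p.2 b).map fun _ =>
          [(p.1.2, true), (b + n p.1.1 * p.2, true), (c + n p.1.1 * (p.1.2 / n p.1.1), false)])
      (Primrec.list_range.comp hn₁) ?_
    have hx₂ : Primrec fun p : ((α × ℕ) × ℕ) × ℕ => p.1.1.1 :=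
      Primrec.fst.comp (Primrec.fst.comp Primrec.fst)
    have hi₂ : Primrec fun p : ((α × ℕ) × ℕ) × ℕ => p.1.1.2 :=
      Primrec.snd.comp (Primrec.fst.comp Primrec.fst)
    have hk₂ : Primrec fun p : ((α × ℕ) × ℕ) × ℕ => p.1.2 := Primrec.snd.comp Primrec.fst
    have hb₂ : Primrec fun p : ((α × ℕ) × ℕ) × ℕ => p.2 := Primrec.snd
    refine Primrec.option_bind (tableOp (hT.comp hx₂)
      (Primrec.nat_mod.comp hi₂ (hn.comp hx₂)) hb₂) ?_
    refine Primrec.option_map ((tableAct (hn.comp hx₂) (hT.comp hx₂) hk₂ hb₂).comp Primrec.fst) ?_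
    have hc₄ : Primrec fun p : ((((α × ℕ) × ℕ) × ℕ) × ℕ) × ℕ => p.1.2 := Primrec.snd.comp Primrec.fst
    have hp₄ : Primrec fun p : ((((α × ℕ) × ℕ) × ℕ) × ℕ) × ℕ => p.1.1 := Primrec.fst.comp Primrec.fst
    have hn₄ := hn.comp (hx₂.comp hp₄)
    have hi₄ := hi₂.comp hp₄
    refine Primrec.list_cons.comp (Primrec.pair hi₄ (Primrec.const true))
      (Primrec.list_cons.comp (Primrec.pair (Primrec.nat_add.comp (hb₂.comp hp₄)
        (Primrec.nat_mul.comp hn₄ (hk₂.comp hp₄))) (Primrec.const true))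
        (Primrec.list_cons.comp (Primrec.pair (Primrec.nat_add.comp hc₄
          (Primrec.nat_mul.comp hn₄ (Primrec.nat_div.comp hi₄ hn₄))) (Primrec.const false))
          (Primrec.const [])))
  · refine Primrec.listFilterMap (g := fun x i => (_root_.pathEntry (r x) i).bind fun w =>
      (_root_.tablePath (n x) (T x) (j x) w).map Prod.snd) (Primrec.list_range.comp hn) ?_
    refine Primrec.option_bind (pathEntry (hr.comp Primrec.fst) Primrec.snd) ?_
    have hx : Primrec fun p : (α × ℕ) × List ℕ => p.1.1 := Primrec.fst.comp Primrec.fst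
    exact Primrec.option_map (g := fun _ q => q.2)
      (tablePath (hn.comp hx) (hT.comp hx) (hj.comp hx) Primrec.snd)
      (Primrec.snd.comp Primrec.snd).to₂

theorem tablePresentation (hn : Primrec n) (hT : Primrec T) (ha : Primrec a) (hr : Primrec r) :
    Primrec fun x => tablePresentation (n x) (T x) (a x) (r x) :=
  Primrec.pair (Primrec.nat_mul.comp hn hn) (tableRelators hn hT
    (Primrec.option_getD.comp (tableAct hn hT ha ha) (Primrec.const 0)) hr)

theorem checkPaths (hn : Primrec n) (hT : Primrec T) (ha : Primrec a) (hr : Primrec r) :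
    Primrec fun x => checkPaths (n x) (T x) (a x) (r x) := by
  have hact := tableAct hn hT ha ha
  refine Primrec.and.comp (eq_decide (Primrec.option_bind hact
    (pathEntry (hr.comp Primrec.fst) Primrec.snd)) (Primrec.const _)) (Primrec.and.comp ?_ ?_)
  · refine list_all (p := fun x j => ((_root_.pathEntry (r x) j).map fun w =>
      decide (((_root_.tableAct (n x) (T x) (a x) (a x)).bind fun j₀ =>
        _root_.tablePath (n x) (T x) j₀ w).map Prod.fst = some j)).getD true)
      (Primrec.list_range.comp hn) ?_
    refine Primrec.option_getD.comp (Primrec.option_map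
      (pathEntry (hr.comp Primrec.fst) Primrec.snd) ?_) (Primrec.const true)
    have hx : Primrec fun p : (α × ℕ) × List ℕ => p.1.1 := Primrec.fst.comp Primrec.fst
    have hx' : Primrec fun p : ((α × ℕ) × List ℕ) × ℕ => p.1.1.1 := hx.comp Primrec.fst
    refine eq_decide (Primrec.option_map (Primrec.option_bind (hact.comp hx)
      (tablePath (hn.comp hx') (hT.comp hx') Primrec.snd (Primrec.snd.comp Primrec.fst)))
      (Primrec.fst.comp Primrec.snd)) (Primrec.option_some.comp (Primrec.snd.comp Primrec.fst))
  · refine list_all (p := fun x i => ((_root_.tableEdge (n x) (T x) (r x) i).map fun k =>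
      (_root_.pathEntry (r x) k).isSome).getD true)
      (Primrec.list_range.comp (Primrec.nat_mul.comp hn hn)) ?_
    refine Primrec.option_getD.comp (Primrec.option_map (tableEdge (hn.comp Primrec.fst)
      (hT.comp Primrec.fst) (hr.comp Primrec.fst) Primrec.snd) ?_) (Primrec.const true)
    exact Primrec.option_isSome.comp
      (pathEntry (hr.comp (Primrec.fst.comp Primrec.fst)) Primrec.snd)

end Primrec

/-! ### The uniform algorithm and the theorem -/

/-- Given the paths to the reachable states for all elements, compute the presentations. -/
def allPresentations (T : List (List (Option ℕ))) (r : List (List (Option (List ℕ)))) :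
    Option (List FinPresentation) :=
  bif (List.range T.length).all fun e => checkPaths T.length T e (r[e]?.getD [])
  then some ((List.range T.length).map fun e => tablePresentation T.length T e (r[e]?.getD []))
  else none

theorem primrec₂_allPresentations : Primrec₂ allPresentations := by
  have hn : Primrec fun p : (List (List (Option ℕ)) × List (List (Option (List ℕ)))) × ℕ =>
      p.1.1.length := Primrec.list_length.comp (Primrec.fst.comp Primrec.fst)
  have hT : Primrec fun p : (List (List (Option ℕ)) × List (List (Option (List ℕ)))) × ℕ =>
      p.1.1 := Primrec.fst.comp Primrec.fst
  have hc : Primrec fun p : (List (List (Option ℕ)) × List (List (Option (List ℕ)))) × ℕ =>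
      p.1.2[p.2]?.getD [] := Primrec.option_getD.comp
    (Primrec.list_getElem?.comp (Primrec.snd.comp Primrec.fst) Primrec.snd) (Primrec.const [])
  have hl : Primrec fun p : List (List (Option ℕ)) × List (List (Option (List ℕ))) =>
      List.range p.1.length := Primrec.list_range.comp (Primrec.list_length.comp Primrec.fst)
  exact Primrec.cond (Primrec.list_all hl (Primrec.checkPaths hn hT Primrec.snd hc))
    (Primrec.option_some.comp (Primrec.list_map hl
      (Primrec.tablePresentation hn hT Primrec.snd hc).to₂)) (Primrec.const none)

/-- One algorithm computes presentations of all maximal subgroups from the table of any finite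
biordered set. -/
theorem exists_partrec_presentations :
    ∃ A : List (List (Option ℕ)) →. List FinPresentation, Partrec A ∧
      ∀ (n : ℕ) (B : BiorderedSet (Fin n)),
        ∃ L ∈ A B.table, L.length = n ∧
          ∀ e : Fin n, ∃ P, L[(e : ℕ)]? = some P ∧ P.Presents (B.MaximalSubgroup e) := by
  -- Codes of path tables are tried in turn until one passes the check for every `e`.
  refine ⟨fun T => Nat.rfindOpt fun m =>
    (Encodable.decode (α := List (List (Option (List ℕ)))) m).bind (allPresentations T),
    Partrec.rfindOpt (Computable.option_bind (Computable.decode.comp Computable.snd)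
      ((primrec₂_allPresentations.comp (Primrec.fst.comp Primrec.fst) Primrec.snd).to_comp)),
    fun n B => ?_⟩
  choose r hr using B.exists_checkPaths_table
  have hex : (allPresentations B.table (List.ofFn r)).isSome = true := by
    have : ((List.range B.table.length).all fun e =>
        checkPaths B.table.length B.table e ((List.ofFn r)[e]?.getD [])) = true := by
      rw [B.length_table, List.all_eq_true]
      intro e he
      lift e to Fin n using List.mem_range.1 he
      simpa using hr e
    rw [allPresentations, this]
    rfl
  obtain ⟨L₀, hL₀⟩ := Option.isSome_iff_exists.1 hex
  have hdom := Nat.rfindOpt_dom (f := fun m =>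
    (Encodable.decode (α := List (List (Option (List ℕ)))) m).bind
      (allPresentations B.table)) |>.2 ⟨Encodable.encode (List.ofFn r), L₀, by simp [hL₀]⟩
  refine ⟨_, Part.get_mem hdom, ?_⟩
  obtain ⟨m, hm⟩ := Nat.rfindOpt_spec (Part.get_mem hdom)
  generalize Part.get _ hdom = L at *
  -- The table `r'` found need not be the `r` that proved termination; passing the check is all that
  -- correctness requires.
  obtain ⟨r', -, hc⟩ := Option.bind_eq_some_iff.1 hm
  rw [allPresentations, B.length_table] at hc
  cases hall : (List.range n).all fun e => checkPaths n B.table e (r'[e]?.getD []) with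
  | false => simp [hall] at hc
  | true =>
    rw [hall, cond_true, Option.some_inj] at hc
    subst hc
    refine ⟨by simp, fun e => ⟨tablePresentation n B.table e (r'[(e : ℕ)]?.getD []), by simp, ?_⟩⟩
    exact B.presents_tablePresentation e
      (List.all_eq_true.1 hall e (List.mem_range.2 e.2))
theorem theorem3p7 :
    -- one algorithm computes presentations of all `H_e` from the table of any finite biordered set
    (∃ A : List (List (Option ℕ)) →. List FinPresentation, Partrec A ∧
      ∀ (n : ℕ) (B : BiorderedSet (Fin n)),
        ∃ L ∈ A B.table, L.length = n ∧
          ∀ e : Fin n, ∃ P, L[(e : ℕ)]? = some P ∧ P.Presents (B.MaximalSubgroup e)) ∧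
    -- the word problem for regular words; the answer `none` means "not both words are regular"
    (∀ (n : ℕ) (B : BiorderedSet (Fin n)),
      (∀ e : Fin n, HasSolvableWordProblem (B.MaximalSubgroup e)) →
        ∃ D : List (Fin n) × List (Fin n) → Option Bool, Computable D ∧
          ∀ u v : List (Fin n),
            ((D (u, v)).isSome = true ↔ B.IsRegularWord u ∧ B.IsRegularWord v) ∧
            (B.IsRegularWord u → B.IsRegularWord v →
              (D (u, v) = some true ↔ B.value u = B.value v))) :=
  ⟨exists_partrec_presentations,
    fun _ B h => B.exists_computable_of_forall_hasSolvableWordProblem h⟩
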